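/- Let $I$ be a finite set, and for each $i\in I$ let $A_i$ be a unital C*-algebra. Let $A=\bigotimes_{i\in I}A_i$ be the minimal (spatial) C*-tensor product, and let $\tilde A_i\subseteq A$ be the C*-subalgebra $\bigotimes_{j\ne i}A_j$, i.e. the closed $*$-subalgebra generated by the elementary tensors $\otimes_j a_j$ with $a_i=1$. For $a\in A$ put $$L_i(a)=2\inf\{\|a-c\|:c\in\tilde A_i\},\qquad L_{qH}(a)=\max_{i\in I}L_i(a).$$ For states $\mu,\nu$ of $A$ put $d_{qH}(\mu,\nu)=\sup\{|\mu(a)-\nu(a)|:a\in A,\ L_{qH}(a)\le 1\}$. For a bounded linear functional $\varphi$ on $A$ that vanishes on $\tilde A_i$ put $\|\varphi\|_i=\sup\{|\varphi(a)|:a\in A,\ L_i(a)\le 1\}$, and let $\varphi^*(a)=\overline{\varphi(a^*)}$. (1) For all states $\mu,\nu$ of $A$ the number $d_{qH}(\mu,\nu)$ is finite, and $$d_{qH}(\mu,\nu)=\inf\Big\{\sum_{i}\|\varphi_i\|_i:\ \varphi_i\in A',\ \varphi_i|_{\tilde A_i}=0,\ \varphi_i^*=\varphi_i,\ \mu-\nu=\sum_i\varphi_i\Big\}.$$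 (2) Suppose that each $A_i$ is a full matrix algebra $M_{n_i}(\mathbb C)$, so that $A$ is the algebra of matrices indexed by $\prod_i\{1,\dots,n_i\}$. Then the relation $\mu(\otimes_i a_i)=\operatorname{Tr}(\rho\,(\otimes_i a_i))$ for all $a_i \in A_i$ is a bijection between the states $\mu$ of $A$ and the density matrices $\rho$, and if $\mu,\nu$ correspond to $\rho,\sigma$, then $d_{qH}(\mu,\nu)$ is the quantum Wasserstein distance of order 1 of De Palma, Marvian, Trevisan and Lloyd: $$d_{qH}(\mu,\nu)=\tfrac12\inf\Big\{\sum_i\|X_i\|_1:\ X_i=X_i^*,\ \operatorname{Tr}_iX_i=0,\ \rho-\sigma=\sum_iX_i\Big\}$$ $$=\inf\Big\{\sum_ic_i:\ c_i\ge 0,\ \rho-\sigma=\sum_ic_i(\rho_i-\sigma_i),\ \rho_i,\sigma_i\text{ density matrices with }\operatorname{Tr}_i\rho_i=\operatorname{Tr}_i\sigma_i\Big\},$$ where $\operatorname{Tr}_i$ is the partial trace over the $i$-th factor and $\|\cdot\|_1$ is the trace norm. -/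

import Mathlib

open scoped ENNReal NNReal ComplexOrder

noncomputable section

namespace QHamming

section HilbertTensor

variable {ι : Type*} [Fintype ι]

/-- The algebraic tensor product of a finite family of Hilbert spaces. It is a type synonym that
will carry the norm coming from the inner product (and not a cross norm of Banach spaces). -/
def PreTensor {ι : Type*} [Fintype ι] (H : ι → Type*) [∀ i, NormedAddCommGroup (H i)]
    [∀ i, InnerProductSpace ℂ (H i)] : Type _ :=
  PiTensorProduct ℂ H

variable (H : ι → Type*) [∀ i, NormedAddCommGroup (H i)] [∀ i, InnerProductSpace ℂ (H i)]

instance : AddCommGroup (PreTensor H) := inferInstanceAs (AddCommGroup (PiTensorProduct ℂ H))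
instance : Module ℂ (PreTensor H) := inferInstanceAs (Module ℂ (PiTensorProduct ℂ H))

variable {H}

/-- The elementary tensor `⊗ ξᵢ` in the algebraic tensor product. -/
def preTprod (ξ : ∀ i, H i) : PreTensor H := PiTensorProduct.tprod ℂ ξ

/-- The linear functional `η ↦ ⟪⊗ ξᵢ, η⟫`. -/
def innerFunctional (ξ : ∀ i, H i) : PreTensor H →ₗ[ℂ] ℂ :=
  PiTensorProduct.lift ((MultilinearMap.mkPiAlgebra ℂ ι ℂ).compLinearMap
    (fun i => (innerSL ℂ (ξ i)).toLinearMap))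

theorem innerFunctional_preTprod (ξ η : ∀ i, H i) :
    innerFunctional ξ (preTprod η) = ∏ i, inner ℂ (ξ i) (η i) := by
  unfold innerFunctional preTprod
  erw [PiTensorProduct.lift.tprod]
  simp

theorem preTensor_ext {f g : PreTensor H →ₗ[ℂ] ℂ} (h : ∀ ξ, f (preTprod ξ) = g (preTprod ξ)) :
    f = g :=
  PiTensorProduct.ext (R := ℂ) (MultilinearMap.ext h)

theorem innerFunctional_update_add [DecidableEq ι] (ξ : ∀ i, H i) (i : ι) (a b : H i) :
    innerFunctional (Function.update ξ i (a + b)) =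
      innerFunctional (Function.update ξ i a) + innerFunctional (Function.update ξ i b) := by
  refine preTensor_ext fun η => ?_
  have key : ∀ c : H i, ∏ j, inner ℂ (Function.update ξ i c j) (η j) =
      inner ℂ c (η i) * ∏ j ∈ Finset.univ.erase i, inner ℂ (ξ j) (η j) := by
    intro c
    rw [← Finset.mul_prod_erase _ _ (Finset.mem_univ i)]
    congr 1
    · simp
    · refine Finset.prod_congr rfl fun j hj => ?_
      rw [Function.update_of_ne (Finset.ne_of_mem_erase hj)]
  simp only [LinearMap.add_apply, innerFunctional_preTprod, key, inner_add_left, add_mul]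

theorem innerFunctional_update_smul [DecidableEq ι] (ξ : ∀ i, H i) (i : ι) (c : ℂ) (a : H i) :
    innerFunctional (Function.update ξ i (c • a)) =
      starRingEnd ℂ c • innerFunctional (Function.update ξ i a) := by
  refine preTensor_ext fun η => ?_
  have key : ∀ c : H i, ∏ j, inner ℂ (Function.update ξ i c j) (η j) =
      inner ℂ c (η i) * ∏ j ∈ Finset.univ.erase i, inner ℂ (ξ j) (η j) := by
    intro c
    rw [← Finset.mul_prod_erase _ _ (Finset.mem_univ i)]
    congr 1
    · simp
    · refine Finset.prod_congr rfl fun j hj => ?_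
      rw [Function.update_of_ne (Finset.ne_of_mem_erase hj)]
  simp only [LinearMap.smul_apply, innerFunctional_preTprod, key, inner_smul_left, smul_eq_mul,
    mul_assoc]

/-- The sesquilinear form, linear in the first and conjugate linear in the second argument, with
`(⊗ ξᵢ, η) ↦ conj ⟪⊗ ξᵢ, η⟫`. -/
def innerForm : PreTensor H →ₗ[ℂ] (PreTensor H →ₛₗ[starRingEnd ℂ] ℂ) :=
  PiTensorProduct.lift
    { toFun := fun ξ =>
        { toFun := fun η => starRingEnd ℂ (innerFunctional ξ η)
          map_add' := fun x y => by simp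
          map_smul' := fun c x => by simp }
      map_update_add' := by
        intro _ ξ i a b
        ext η
        simp [innerFunctional_update_add]
      map_update_smul' := by
        intro _ ξ i c a
        ext η
        simp [innerFunctional_update_smul] }

theorem innerForm_preTprod (ξ : ∀ i, H i) (η : PreTensor H) :
    innerForm (preTprod ξ) η = starRingEnd ℂ (innerFunctional ξ η) := by
  unfold innerForm preTprod
  erw [PiTensorProduct.lift.tprod]
  rfl

theorem innerForm_preTprod_preTprod (ξ η : ∀ i, H i) :
    innerForm (preTprod ξ) (preTprod η) = ∏ i, inner ℂ (η i) (ξ i) := by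
  rw [innerForm_preTprod, innerFunctional_preTprod, map_prod]
  simp

theorem exists_sum (x : PreTensor H) :
    ∃ (n : ℕ) (c : Fin n → ℂ) (v : Fin n → ∀ i, H i), x = ∑ k, c k • preTprod (v k) := by
  have hx : x ∈ Submodule.span ℂ (Set.range (preTprod (H := H))) := by
    have h1 := PiTensorProduct.span_tprod_eq_top (R := ℂ) (s := H)
    have h2 : (x : PiTensorProduct ℂ H) ∈ (⊤ : Submodule ℂ (PiTensorProduct ℂ H)) := trivial
    rw [← h1] at h2
    exact h2
  obtain ⟨n, c, g, hg⟩ := Submodule.mem_span_set'.mp hx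
  choose v hv using fun k => (g k).2
  exact ⟨n, c, v, by simp only [hv, hg]⟩

/-- The product kernel of inner products is positive semidefinite. -/
theorem posSemidef_kernel {n : Type*} [Fintype n] (v : n → ∀ i, H i) (s : Finset ι) :
    (Matrix.of fun k l => ∏ i ∈ s, inner ℂ (v k i) (v l i)).PosSemidef := by
  classical
  induction s using Finset.induction_on with
  | empty =>
    have h1 : (Matrix.of fun k l => ∏ i ∈ (∅ : Finset ι), inner ℂ (v k i) (v l i)) =
        Matrix.gram ℂ (fun _ : n => (1 : ℂ)) := by
      ext k l
      simp [Matrix.gram]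
    rw [h1]
    exact Matrix.posSemidef_gram (𝕜 := ℂ) (fun _ : n => (1 : ℂ))
  | insert i s hi ih =>
    have h1 : (Matrix.of fun k l => ∏ i ∈ insert i s, inner ℂ (v k i) (v l i)) =
        (Matrix.gram ℂ (fun k => v k i)).hadamard
          (Matrix.of fun k l => ∏ i ∈ s, inner ℂ (v k i) (v l i)) := by
      ext k l
      simp [Matrix.gram, Finset.prod_insert hi]
    rw [h1]
    exact (Matrix.posSemidef_gram (𝕜 := ℂ) (fun k => v k i)).hadamard ih

theorem innerForm_sum {n : ℕ} (c : Fin n → ℂ) (v : Fin n → ∀ i, H i) :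
    innerForm (∑ k, c k • preTprod (v k)) (∑ k, c k • preTprod (v k)) =
      star c ⬝ᵥ (Matrix.of fun k l => ∏ i, inner ℂ (v k i) (v l i)).mulVec c := by
  simp only [map_sum, LinearMap.sum_apply, map_smul, LinearMap.smul_apply,
    LinearMap.map_smulₛₗ, innerForm_preTprod_preTprod, smul_eq_mul, dotProduct, Matrix.mulVec,
    Finset.mul_sum, Matrix.of_apply, Pi.star_apply, RCLike.star_def]
  refine Finset.sum_congr rfl fun k _ => Finset.sum_congr rfl fun l _ => ?_
  ring

theorem innerForm_conj_symm (x y : PreTensor H) :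
    starRingEnd ℂ (innerForm x y) = innerForm y x := by
  obtain ⟨n, c, v, rfl⟩ := exists_sum x
  obtain ⟨m, d, w, rfl⟩ := exists_sum y
  simp only [map_sum, LinearMap.sum_apply, map_smul, LinearMap.smul_apply,
    LinearMap.map_smulₛₗ, innerForm_preTprod_preTprod, smul_eq_mul, map_mul, map_prod,
    inner_conj_symm, RCLike.conj_conj, Finset.mul_sum]
  rw [Finset.sum_comm]
  refine Finset.sum_congr rfl fun k _ => Finset.sum_congr rfl fun l _ => ?_
  ring

/-- The (semi-)inner product with `⟪⊗ ξᵢ, ⊗ ηᵢ⟫ = ∏ᵢ ⟪ξᵢ, ηᵢ⟫`. -/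
abbrev preTensorCore : PreInnerProductSpace.Core ℂ (PreTensor H) where
  inner x y := innerForm y x
  conj_inner_symm x y := innerForm_conj_symm x y
  re_inner_nonneg x := by
    obtain ⟨n, c, v, rfl⟩ := exists_sum x
    rw [innerForm_sum]
    exact (Complex.nonneg_iff.mp ((posSemidef_kernel v Finset.univ).dotProduct_mulVec_nonneg c)).1
  add_left x y z := by simp
  smul_left x y r := by simp

instance : SeminormedAddCommGroup (PreTensor H) :=
  InnerProductSpace.Core.toSeminormedAddCommGroup (c := preTensorCore)
instance : InnerProductSpace ℂ (PreTensor H) :=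
  InnerProductSpace.ofCore preTensorCore

theorem inner_eq_innerForm (x y : PreTensor H) : inner ℂ x y = innerForm y x := rfl

theorem inner_preTprod (ξ η : ∀ i, H i) :
    inner ℂ (preTprod ξ) (preTprod η) = ∏ i, inner ℂ (ξ i) (η i) := by
  rw [inner_eq_innerForm, innerForm_preTprod_preTprod]

variable (H) in
/-- The Hilbert space tensor product `⊗ᵢ Hᵢ`. -/
abbrev HilbertTensor : Type _ := UniformSpace.Completion (PreTensor H)

/-- The algebraic tensor product of operators. -/
def preMap (T : ∀ i, H i →L[ℂ] H i) : PreTensor H →ₗ[ℂ] PreTensor H :=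
  PiTensorProduct.map fun i => (T i).toLinearMap

theorem preMap_preTprod (T : ∀ i, H i →L[ℂ] H i) (ξ : ∀ i, H i) :
    preMap T (preTprod ξ) = preTprod fun i => T i (ξ i) :=
  PiTensorProduct.map_tprod _ _

theorem preMap_mul (S T : ∀ i, H i →L[ℂ] H i) (x : PreTensor H) :
    preMap (fun i => S i * T i) x = preMap S (preMap T x) := by
  obtain ⟨n, c, v, rfl⟩ := exists_sum x
  simp [preMap_preTprod]

theorem preMap_one (x : PreTensor H) : preMap (fun i => (1 : H i →L[ℂ] H i)) x = x := by
  obtain ⟨n, c, v, rfl⟩ := exists_sum x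
  simp [preMap_preTprod]

theorem norm_preMap_single_le [DecidableEq ι] (i : ι) (T : H i →L[ℂ] H i) (x : PreTensor H) :
    ‖preMap (Function.update (fun j => (1 : H j →L[ℂ] H j)) i T) x‖ ≤ ‖T‖ * ‖x‖ := by
  obtain ⟨n, c, v, rfl⟩ := exists_sum x
  set w : Fin n → ∀ j, H j := fun k => Function.update (v k) i (T (v k i)) with hw
  have h1 : preMap (Function.update (fun j => (1 : H j →L[ℂ] H j)) i T)
      (∑ k, c k • preTprod (v k)) = ∑ k, c k • preTprod (w k) := by
    simp only [map_sum, map_smul, preMap_preTprod]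
    refine Finset.sum_congr rfl fun k _ => ?_
    congr 2
    funext j
    by_cases hj : j = i
    · subst hj; simp [hw]
    · simp [hw, hj]
  have hn : ∀ x : PreTensor H, ‖x‖ ^ 2 = (innerForm x x).re := fun x =>
    InnerProductSpace.norm_sq_eq_re_inner (𝕜 := ℂ) x
  rw [h1, ← sq_le_sq₀ (norm_nonneg _) (by positivity), mul_pow, hn, hn, innerForm_sum,
    innerForm_sum]
  have hpos := ((Matrix.posSemidef_opNorm_smul_gram_sub_gram (𝕜 := ℂ) (fun k => v k i) T).hadamard
    (posSemidef_kernel v (Finset.univ.erase i))).dotProduct_mulVec_nonneg c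
  have hmat : ((‖T‖ ^ 2 • Matrix.gram ℂ (fun k => v k i) -
      Matrix.gram ℂ (T ∘ fun k => v k i)).hadamard
      (Matrix.of fun k l => ∏ j ∈ Finset.univ.erase i, inner ℂ (v k j) (v l j))) =
      ((‖T‖ ^ 2 : ℝ) : ℂ) • (Matrix.of fun k l => ∏ j, inner ℂ (v k j) (v l j)) -
        (Matrix.of fun k l => ∏ j, inner ℂ (w k j) (w l j)) := by
    ext k l
    have e1 : ∏ j ∈ Finset.univ.erase i, inner ℂ (w k j) (w l j) =
        ∏ j ∈ Finset.univ.erase i, inner ℂ (v k j) (v l j) := by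
      refine Finset.prod_congr rfl fun j hj => ?_
      simp [hw, Finset.ne_of_mem_erase hj]
    simp only [Matrix.hadamard_apply, Matrix.sub_apply, Matrix.smul_apply, Matrix.of_apply,
      ← Finset.mul_prod_erase Finset.univ _ (Finset.mem_univ i), e1, Matrix.gram_apply]
    simp [hw]
    ring
  rw [hmat, Matrix.sub_mulVec, Matrix.smul_mulVec, dotProduct_sub, dotProduct_smul] at hpos
  have hre := (Complex.nonneg_iff.mp hpos).1
  rw [Complex.sub_re, smul_eq_mul, Complex.re_ofReal_mul] at hre
  exact sub_nonneg.mp hre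

theorem exists_norm_preMap_le (T : ∀ i, H i →L[ℂ] H i) :
    ∃ C, ∀ x, ‖preMap T x‖ ≤ C * ‖x‖ := by
  classical
  have key : ∀ s : Finset ι, ∃ C, 0 ≤ C ∧
      ∀ x, ‖preMap (fun i => if i ∈ s then T i else 1) x‖ ≤ C * ‖x‖ := by
    intro s
    induction s using Finset.induction_on with
    | empty => exact ⟨1, zero_le_one, fun x => by simp [preMap_one]⟩
    | insert i s hi ih =>
      obtain ⟨C, hC, h⟩ := ih
      refine ⟨‖T i‖ * C, by positivity, fun x => ?_⟩
      have e : (fun j => if j ∈ insert i s then T j else 1) =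
          fun j => Function.update (fun j => (1 : H j →L[ℂ] H j)) i (T i) j *
            (if j ∈ s then T j else 1) := by
        funext j
        by_cases hj : j = i
        · subst hj; simp [hi]
        · simp [hj]
      rw [e, preMap_mul, mul_assoc]
      exact (norm_preMap_single_le i (T i) _).trans
        (mul_le_mul_of_nonneg_left (h x) (norm_nonneg _))
  obtain ⟨C, -, h⟩ := key Finset.univ
  exact ⟨C, fun x => by simpa using h x⟩

/-- The elementary tensor `⊗ ξᵢ` in the Hilbert space tensor product. -/
def vecTensor (ξ : ∀ i, H i) : HilbertTensor H := (preTprod ξ : PreTensor H)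

/-- The bounded operator `⊗ᵢ Tᵢ` on `⊗ᵢ Hᵢ`. -/
def opTensor (T : ∀ i, H i →L[ℂ] H i) : HilbertTensor H →L[ℂ] HilbertTensor H :=
  ((preMap T).mkContinuousOfExistsBound (exists_norm_preMap_le T)).completion

theorem inner_vecTensor (ξ η : ∀ i, H i) :
    inner ℂ (vecTensor ξ) (vecTensor η) = ∏ i, inner ℂ (ξ i) (η i) := by
  rw [vecTensor, vecTensor, UniformSpace.Completion.inner_coe, inner_preTprod]

theorem opTensor_vecTensor (T : ∀ i, H i →L[ℂ] H i) (ξ : ∀ i, H i) :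
    opTensor T (vecTensor ξ) = vecTensor fun i => T i (ξ i) := by
  rw [opTensor, vecTensor, ContinuousLinearMap.completion_apply_coe]
  exact congrArg _ (preMap_preTprod T ξ)

end HilbertTensor

section MinTensor

variable {ι : Type*} [Fintype ι] {A : ι → Type*} [∀ i, CStarAlgebra (A i)]
  {H : ι → Type*} [∀ i, NormedAddCommGroup (H i)] [∀ i, InnerProductSpace ℂ (H i)]
  [∀ i, CompleteSpace (H i)]

/-- The spatial (minimal) C*-tensor product `⊗ᵢ Aᵢ` of unital C*-algebras given with faithful
unital representations `πᵢ` on Hilbert spaces `Hᵢ`: the norm closed *-algebra of operators on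
`⊗ᵢ Hᵢ` generated by the operators `⊗ᵢ πᵢ(aᵢ)`. -/
def minTensor (π : ∀ i, A i →⋆ₐ[ℂ] (H i →L[ℂ] H i)) :
    StarSubalgebra ℂ (HilbertTensor H →L[ℂ] HilbertTensor H) :=
  (StarAlgebra.adjoin ℂ
    (Set.range fun a : ∀ i, A i => opTensor fun i => π i (a i))).topologicalClosure

variable (π : ∀ i, A i →⋆ₐ[ℂ] (H i →L[ℂ] H i))

/-- The elementary tensor `⊗ᵢ aᵢ` in `⊗ᵢ Aᵢ`. -/
def elemTensor (a : ∀ i, A i) : minTensor π :=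
  ⟨opTensor fun i => π i (a i),
    StarSubalgebra.le_topologicalClosure _ (StarAlgebra.subset_adjoin ℂ _ ⟨a, rfl⟩)⟩

/-- The C*-subalgebra `Ãᵢ = ⊗_{j ≠ i} Aⱼ` of `⊗ⱼ Aⱼ`, generated by the elementary tensors whose
`i`-th factor is `1`. -/
def tilde (i : ι) : StarSubalgebra ℂ (minTensor π) :=
  (StarAlgebra.adjoin ℂ {x | ∃ a : ∀ j, A j, a i = 1 ∧ x = elemTensor π a}).topologicalClosure

/-- `Lᵢ(a) = 2 inf {‖a - c‖ : c ∈ Ãᵢ}`. -/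
def partialL (i : ι) (a : minTensor π) : ℝ := 2 * ⨅ c : tilde π i, ‖a - c‖

/-- The quantum Hamming seminorm `L_qH(a) = maxᵢ Lᵢ(a)`. -/
def hammingL (a : minTensor π) : ℝ := ⨆ i, partialL π i a

/-- The distance on states (with values in `[0, ∞]`) determined by `L_qH`. -/
def hammingDist (μ ν : minTensor π →L[ℂ] ℂ) : ℝ≥0∞ :=
  ⨆ (a : minTensor π) (_ : hammingL π a ≤ 1), ENNReal.ofReal ‖μ a - ν a‖

/-- The norm (with values in `[0, ∞]`) dual to `Lᵢ`. -/
def dualNorm (i : ι) (φ : minTensor π →L[ℂ] ℂ) : ℝ≥0∞ :=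
  ⨆ (a : minTensor π) (_ : partialL π i a ≤ 1), ENNReal.ofReal ‖φ a‖

end MinTensor

/-- A state on a unital C*-algebra: a positive linear functional of norm one. -/
def IsState {B : Type*} [NormedRing B] [StarRing B] [NormedAlgebra ℂ B] (φ : B →L[ℂ] ℂ) : Prop :=
  (∀ b, 0 ≤ φ (star b * b)) ∧ ‖φ‖ = 1

/-- The functionals with `φ = φ*`, where `φ*(b) = conj φ(b*)`. -/
def IsSelfAdjointFunctional {B : Type*} [NormedRing B] [StarRing B] [NormedAlgebra ℂ B]
    (φ : B →L[ℂ] ℂ) : Prop :=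
  ∀ b, starRingEnd ℂ (φ (star b)) = φ b

section Matrices

variable {ι : Type*} [Fintype ι] [DecidableEq ι] {κ : ι → Type*} [∀ i, Fintype (κ i)]
  [∀ i, DecidableEq (κ i)]

/-- Density matrices. -/
def IsDensityMatrix {n : Type*} [Fintype n] (ρ : Matrix n n ℂ) : Prop :=
  ρ.PosSemidef ∧ ρ.trace = 1

/-- The trace norm: the sum of the singular values, that is, of the square roots of the
eigenvalues of `Xᴴ X`. -/
def traceNorm {n : Type*} [Fintype n] [DecidableEq n] (X : Matrix n n ℂ) : ℝ :=
  ∑ k, √((Matrix.isHermitian_conjTranspose_mul_self X).eigenvalues k)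

/-- The partial trace over the `i`-th factor of `⊗ⱼ M_{κⱼ}(ℂ)`, the latter identified with the
matrices indexed by `∏ⱼ κⱼ`. -/
def partialTrace (i : ι) (X : Matrix (∀ j, κ j) (∀ j, κ j) ℂ) :
    Matrix (∀ j : {j // j ≠ i}, κ j) (∀ j : {j // j ≠ i}, κ j) ℂ :=
  Matrix.of fun k l => ∑ m : κ i,
    X ((Equiv.piSplitAt i κ).symm (m, k)) ((Equiv.piSplitAt i κ).symm (m, l))

/-- The Kronecker product `⊗ᵢ aᵢ` of a finite family of matrices. -/
def kron (a : ∀ i, CStarMatrix (κ i) (κ i) ℂ) : Matrix (∀ i, κ i) (∀ i, κ i) ℂ :=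
  Matrix.of fun k l => ∏ i, a i (k i) (l i)

/-- The quantum Wasserstein distance of order 1, in its form with trace norms:
`½ inf ∑ᵢ ‖Xᵢ‖₁` over decompositions `ρ - σ = ∑ᵢ Xᵢ` with `Xᵢ` Hermitian and `Trᵢ Xᵢ = 0`. -/
def wassersteinOne (ρ σ : Matrix (∀ i, κ i) (∀ i, κ i) ℂ) : ℝ≥0∞ :=
  ⨅ (X : ι → Matrix (∀ i, κ i) (∀ i, κ i) ℂ)
    (_ : (∀ i, (X i).IsHermitian ∧ partialTrace i (X i) = 0) ∧ ρ - σ = ∑ i, X i),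
    ENNReal.ofReal (1 / 2 * ∑ i, traceNorm (X i))

/-- The quantum Wasserstein distance of order 1, in its form with neighboring states:
`inf ∑ᵢ cᵢ` over decompositions `ρ - σ = ∑ᵢ cᵢ (ρᵢ - σᵢ)` with `cᵢ ≥ 0` and density matrices
`ρᵢ`, `σᵢ` such that `Trᵢ ρᵢ = Trᵢ σᵢ`. -/
def wassersteinOneNeighbor (ρ σ : Matrix (∀ i, κ i) (∀ i, κ i) ℂ) : ℝ≥0∞ :=
  ⨅ (c : ι → ℝ≥0) (R : ι → Matrix (∀ i, κ i) (∀ i, κ i) ℂ)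
    (S : ι → Matrix (∀ i, κ i) (∀ i, κ i) ℂ)
    (_ : (∀ i, IsDensityMatrix (R i) ∧ IsDensityMatrix (S i) ∧
        partialTrace i (R i) = partialTrace i (S i)) ∧
      ρ - σ = ∑ i, ((c i : ℝ) : ℂ) • (R i - S i)),
    ∑ i, (c i : ℝ≥0∞)

/-- The functional `μ` on `⊗ᵢ M_{κᵢ}(ℂ)` is given by the matrix `ρ`, that is,
`μ(⊗ aᵢ) = Tr (ρ ⊗ aᵢ)`. -/
def IsGivenBy {H : ι → Type*} [∀ i, NormedAddCommGroup (H i)] [∀ i, InnerProductSpace ℂ (H i)]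
    [∀ i, CompleteSpace (H i)]
    (π : ∀ i, CStarMatrix (κ i) (κ i) ℂ →⋆ₐ[ℂ] (H i →L[ℂ] H i))
    (μ : minTensor π →L[ℂ] ℂ) (ρ : Matrix (∀ i, κ i) (∀ i, κ i) ℂ) : Prop :=
  ∀ a : ∀ i, CStarMatrix (κ i) (κ i) ℂ, μ (elemTensor π a) = (ρ * kron a).trace

end Matrices

end QHamming

end

noncomputable section

namespace QHamming

/-! ### Tensor products of operators on the Hilbert space tensor product. -/

section OperatorTensor

variable {ι : Type*} [Fintype ι] {H : ι → Type*} [∀ i, NormedAddCommGroup (H i)]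
  [∀ i, InnerProductSpace ℂ (H i)]

/-! Finiteness in (1). Slicing the `i`-th factor with a vector state `ω` is the map `Eᵢ` sending `⊗
aⱼ` to the same tensor with `aᵢ` replaced by `ω(aᵢ) 1`. It is contractive for the spatial norm
(`norm_ofTensor_slice_le`) and fixes the tensors whose `i`-th factor is `1`, so `a - Eᵢ a` has norm
at most `2 dist(a, Ãᵢ)`. The product of all `Eᵢ` has scalar values, and `μ - ν` kills scalars.
Telescoping over the factors therefore bounds `|μ(a) - ν(a)|` by a multiple of the sum of the
distances (`norm_apply_le_sum_dist`).

Duality in (1). One inequality is evaluation of a decomposition. For the other, send `a` to its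
classes in the product of the quotients `A / Ãᵢ` with the sup norm. By the definition of `d_qH`, the
functional `μ - ν` factors through the image of this map with norm at most `2 d_qH`; the `2` is the
one in `Lᵢ`. A Hahn-Banach extension to the whole product splits into components, and the dual of a
sup norm is a sum of norms (`exists_sum_eq_of_le_infDist`). Passing to self-adjoint parts increases
no dual norm and leaves the sum `μ - ν` unchanged.

Part (2). `ofMatrixLin` is a *-isomorphism from the matrices indexed by `∏ᵢ κᵢ` onto the tensor
product, so functionals are matrices through the trace pairing. States become density matrices,
self-adjointness becomes Hermiticity, vanishing on `Ãᵢ` becomes `Trᵢ X = 0`, and the dual norm of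
such a functional is half the trace norm (`dualNorm_eq_traceNorm`). The infimum in (1) is then term
by term the one with trace norms. The form with neighboring states follows from the Jordan
decomposition `X = P - N`, in which `Trᵢ X = 0` forces `P` and `N` to have the same trace. -/

theorem continuousLinearMap_ext_vecTensor {S T : HilbertTensor H →L[ℂ] HilbertTensor H}
    (h : ∀ ξ, S (vecTensor ξ) = T (vecTensor ξ)) : S = T := by
  refine ContinuousLinearMap.ext fun x => ?_
  induction x using UniformSpace.Completion.induction_on with
  | hp => exact isClosed_eq S.continuous T.continuous
  | ih x =>
    obtain ⟨n, c, v, rfl⟩ := exists_sum x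
    have e : ((∑ k, c k • preTprod (v k) : PreTensor H) : HilbertTensor H) =
        ∑ k, c k • vecTensor (v k) := by
      rw [← UniformSpace.Completion.coe_toComplL (𝕜 := ℂ), map_sum]
      simp only [map_smul]
      rfl
    rw [e]
    simp [h]

theorem vecTensor_update_add [DecidableEq ι] (ξ : ∀ i, H i) (i : ι) (a b : H i) :
    vecTensor (Function.update ξ i (a + b)) =
      vecTensor (Function.update ξ i a) + vecTensor (Function.update ξ i b) := by
  simp only [vecTensor, ← UniformSpace.Completion.coe_add]
  exact congrArg _ ((PiTensorProduct.tprod ℂ).map_update_add ξ i a b)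

theorem vecTensor_update_smul [DecidableEq ι] (ξ : ∀ i, H i) (i : ι) (c : ℂ) (a : H i) :
    vecTensor (Function.update ξ i (c • a)) = c • vecTensor (Function.update ξ i a) := by
  simp only [vecTensor, ← UniformSpace.Completion.coe_smul]
  exact congrArg _ ((PiTensorProduct.tprod ℂ).map_update_smul ξ i c a)

omit [Fintype ι] in
theorem update_apply_apply [DecidableEq ι] (T : ∀ i, H i →L[ℂ] H i) (i : ι) (a : H i →L[ℂ] H i)
    (ξ : ∀ i, H i) :
    (fun j => Function.update T i a j (ξ j)) = Function.update (fun j => T j (ξ j)) i (a (ξ i)) := by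
  funext j
  by_cases hj : j = i
  · subst hj; simp
  · simp [hj]

/-- The operator `⊗ᵢ Tᵢ` as a multilinear function of the family `T`. -/
def opTensorMultilinear :
    MultilinearMap ℂ (fun i => H i →L[ℂ] H i) (HilbertTensor H →L[ℂ] HilbertTensor H) where
  toFun := opTensor
  map_update_add' := by
    intro _ T i a b
    refine continuousLinearMap_ext_vecTensor fun ξ => ?_
    simp only [add_apply, opTensor_vecTensor, update_apply_apply,
      vecTensor_update_add]
  map_update_smul' := by
    intro _ T i c a
    refine continuousLinearMap_ext_vecTensor fun ξ => ?_
    simp only [smul_apply, opTensor_vecTensor, update_apply_apply,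
      vecTensor_update_smul]

theorem opTensor_mul (S T : ∀ i, H i →L[ℂ] H i) :
    opTensor (fun i => S i * T i) = opTensor S * opTensor T := by
  refine continuousLinearMap_ext_vecTensor fun ξ => ?_
  simp [opTensor_vecTensor]

theorem opTensor_one : opTensor (fun i => (1 : H i →L[ℂ] H i)) = 1 := by
  refine continuousLinearMap_ext_vecTensor fun ξ => ?_
  simp [opTensor_vecTensor]

theorem ext_inner_vecTensor {x y : HilbertTensor H}
    (h : ∀ ξ, inner ℂ (vecTensor ξ) x = inner ℂ (vecTensor ξ) y) : x = y := by
  refine ext_inner_left ℂ fun z => ?_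
  induction z using UniformSpace.Completion.induction_on with
  | hp => exact isClosed_eq (by fun_prop) (by fun_prop)
  | ih z =>
    obtain ⟨n, c, v, rfl⟩ := exists_sum z
    have e : ((∑ k, c k • preTprod (v k) : PreTensor H) : HilbertTensor H) =
        ∑ k, c k • vecTensor (v k) := by
      rw [← UniformSpace.Completion.coe_toComplL (𝕜 := ℂ), map_sum]
      simp only [map_smul]
      rfl
    rw [e]
    simp only [sum_inner, inner_smul_left, h]

theorem opTensor_star [∀ i, CompleteSpace (H i)] (T : ∀ i, H i →L[ℂ] H i) :
    opTensor (fun i => star (T i)) = star (opTensor T) := by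
  refine continuousLinearMap_ext_vecTensor fun ξ => ext_inner_vecTensor fun η => ?_
  rw [ContinuousLinearMap.star_eq_adjoint (opTensor T), ContinuousLinearMap.adjoint_inner_right,
    opTensor_vecTensor, opTensor_vecTensor, inner_vecTensor, inner_vecTensor]
  refine Finset.prod_congr rfl fun i _ => ?_
  rw [ContinuousLinearMap.star_eq_adjoint, ContinuousLinearMap.adjoint_inner_right]

theorem nontrivial_hilbertTensor [∀ i, Nontrivial (H i)] : Nontrivial (HilbertTensor H) := by
  choose ξ hξ using fun i => exists_ne (0 : H i)
  refine ⟨vecTensor ξ, 0, fun h => ?_⟩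
  have h1 := inner_vecTensor ξ ξ
  rw [h, inner_zero_left, eq_comm, Finset.prod_eq_zero_iff] at h1
  obtain ⟨i, -, hi⟩ := h1
  exact hξ i (inner_self_eq_zero.mp hi)

end OperatorTensor

/-! ### Rank one compressions in a single factor, and a norm bound for slices. -/

section Slice

variable {ι : Type*} [Fintype ι] [DecidableEq ι] {H : ι → Type*} [∀ i, NormedAddCommGroup (H i)]
  [∀ i, InnerProductSpace ℂ (H i)] [∀ i, CompleteSpace (H i)]

/-- The operator acting as `T` on the `i`-th factor of `⊗ⱼ Hⱼ`. -/
def ampliation (i : ι) (T : H i →L[ℂ] H i) : HilbertTensor H →L[ℂ] HilbertTensor H :=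
  opTensor (Function.update (fun j => (1 : H j →L[ℂ] H j)) i T)

omit [∀ i, CompleteSpace (H i)] in
theorem ampliation_vecTensor (i : ι) (T : H i →L[ℂ] H i) (ξ : ∀ i, H i) :
    ampliation i T (vecTensor ξ) = vecTensor (Function.update ξ i (T (ξ i))) := by
  rw [ampliation, opTensor_vecTensor, update_apply_apply]
  rfl

omit [∀ i, CompleteSpace (H i)] in
theorem ampliation_mul (i : ι) (S T : H i →L[ℂ] H i) :
    ampliation i (S * T) = ampliation i S * ampliation i T := by
  refine continuousLinearMap_ext_vecTensor fun ξ => ?_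
  simp [ampliation_vecTensor]

theorem ampliation_star (i : ι) (T : H i →L[ℂ] H i) :
    ampliation i (star T) = star (ampliation i T) := by
  rw [ampliation, ampliation, ← opTensor_star]
  congr 1
  funext j
  by_cases hj : j = i
  · subst hj; simp
  · simp [hj]

omit [∀ i, CompleteSpace (H i)] in
theorem ampliation_sum {n : Type*} (i : ι) (s : Finset n) (T : n → (H i →L[ℂ] H i)) :
    ampliation i (∑ k ∈ s, T k) = ∑ k ∈ s, ampliation i (T k) :=
  map_sum (opTensorMultilinear.toLinearMap (fun j => (1 : H j →L[ℂ] H j)) i) T s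

omit [∀ i, CompleteSpace (H i)] in
theorem ampliation_mul_opTensor_mul (i : ι) (S S' : H i →L[ℂ] H i) (T : ∀ i, H i →L[ℂ] H i) :
    ampliation i S * opTensor T * ampliation i S' =
      opTensor (Function.update T i (S * T i * S')) := by
  refine continuousLinearMap_ext_vecTensor fun ξ => ?_
  rw [opTensor_vecTensor, update_apply_apply]
  change ampliation i S (opTensor T (ampliation i S' (vecTensor ξ))) = _
  rw [ampliation_vecTensor, opTensor_vecTensor, ampliation_vecTensor]
  congr 1
  funext j
  by_cases hj : j = i
  · subst hj; simp
  · simp [hj]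

end Slice

section SliceBound

variable {ι : Type*} [Fintype ι] [DecidableEq ι] {H : ι → Type*} [∀ i, NormedAddCommGroup (H i)]
  [∀ i, InnerProductSpace ℂ (H i)] [∀ i, CompleteSpace (H i)]

/-- The operator `|e⟩⟨f|` on the `i`-th factor of `⊗ⱼ Hⱼ`. -/
def rankOneAt (i : ι) (e f : H i) : HilbertTensor H →L[ℂ] HilbertTensor H :=
  ampliation i (InnerProductSpace.rankOne ℂ e f)

theorem rankOneAt_star (i : ι) (e f : H i) : star (rankOneAt i e f) = rankOneAt i f e := by
  rw [rankOneAt, rankOneAt, ← ampliation_star, ContinuousLinearMap.star_eq_adjoint,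
    InnerProductSpace.adjoint_rankOne]

omit [∀ i, CompleteSpace (H i)] in
theorem rankOneAt_mul_rankOneAt (i : ι) (e f g : H i) (hf : ‖f‖ = 1) :
    rankOneAt i e f * rankOneAt i f g = rankOneAt i e g := by
  rw [rankOneAt, rankOneAt, rankOneAt, ← ampliation_mul]
  congr 1
  ext x
  simp [InnerProductSpace.rankOne_apply, hf, inner_self_eq_norm_sq_to_K]

/-- Bessel's inequality in the `i`-th factor: with `W l = |ξ⟩⟨e l|`, the sum of the `(W l)* W l` is
the ampliation of the projection `Q` onto the span of the `e l`. -/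
theorem sum_norm_rankOneAt_sq_le {n : Type*} [Fintype n] (i : ι) {ξ : H i} (hξ : ‖ξ‖ = 1)
    {e : n → H i} (he : Orthonormal ℂ e) (x : HilbertTensor H) :
    ∑ l, ‖rankOneAt i ξ (e l) x‖ ^ 2 ≤ ‖x‖ ^ 2 := by
  classical
  set Q : H i →L[ℂ] H i := ∑ l, InnerProductSpace.rankOne ℂ (e l) (e l) with hQ
  have hQ2 : Q * Q = Q := by
    ext x
    change Q (Q x) = Q x
    simp only [hQ, sum_apply, InnerProductSpace.rankOne_apply,
      he.inner_right_fintype]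
  have hQs : star Q = Q := by
    simp [hQ, ContinuousLinearMap.star_eq_adjoint]
  have h1 : ∀ l, ‖rankOneAt i ξ (e l) x‖ ^ 2 = (inner ℂ x (rankOneAt i (e l) (e l) x)).re := by
    intro l
    rw [← rankOneAt_mul_rankOneAt i (e l) ξ (e l) hξ, ← rankOneAt_star i ξ (e l),
      ContinuousLinearMap.star_eq_adjoint]
    change _ = (inner ℂ x ((rankOneAt i ξ (e l)).adjoint (rankOneAt i ξ (e l) x))).re
    rw [ContinuousLinearMap.adjoint_inner_right]
    exact InnerProductSpace.norm_sq_eq_re_inner (𝕜 := ℂ) _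
  have h2 : ∑ l, ‖rankOneAt i ξ (e l) x‖ ^ 2 = (inner ℂ x (ampliation i Q x)).re := by
    simp only [h1, hQ, ampliation_sum, sum_apply, inner_sum, Complex.re_sum]
    rfl
  have h3 : ‖ampliation i Q x‖ ^ 2 = (inner ℂ x (ampliation i Q x)).re := by
    have : ampliation i Q = (ampliation i Q).adjoint * ampliation i Q := by
      rw [← ContinuousLinearMap.star_eq_adjoint, ← ampliation_star, hQs, ← ampliation_mul, hQ2]
    conv_rhs => rw [this]
    change _ = (inner ℂ x ((ampliation i Q).adjoint (ampliation i Q x))).re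
    rw [ContinuousLinearMap.adjoint_inner_right]
    exact InnerProductSpace.norm_sq_eq_re_inner (𝕜 := ℂ) _
  have h4 : (inner ℂ x (ampliation i Q x)).re ≤ ‖x‖ * ‖ampliation i Q x‖ :=
    re_inner_le_norm (𝕜 := ℂ) _ _
  rw [h2]
  nlinarith [norm_nonneg x, norm_nonneg (ampliation i Q x), sq_nonneg (‖x‖ - ‖ampliation i Q x‖)]

omit [∀ i, CompleteSpace (H i)] in
-- An algebraic tensor involves only finitely many vectors of `H i`; an orthonormal basis of their
-- span serves. This keeps all later sums finite.
theorem exists_orthonormal_rankOneAt_sum (i : ι) (y : PreTensor H) :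
    ∃ (m : ℕ) (e : Fin m → H i), Orthonormal ℂ e ∧
      ∑ l, rankOneAt i (e l) (e l) (y : HilbertTensor H) = y := by
  obtain ⟨n, c, v, rfl⟩ := exists_sum y
  let F := Submodule.span ℂ (Set.range fun k => v k i)
  have : FiniteDimensional ℂ F := FiniteDimensional.span_of_finite ℂ (Set.finite_range _)
  let b := stdOrthonormalBasis ℂ F
  refine ⟨_, fun l => (b l : H i), b.orthonormal.comp_linearIsometry F.subtypeₗᵢ, ?_⟩
  have e : ((∑ k, c k • preTprod (v k) : PreTensor H) : HilbertTensor H) =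
      ∑ k, c k • vecTensor (v k) := by
    rw [← UniformSpace.Completion.coe_toComplL (𝕜 := ℂ), map_sum]
    simp only [map_smul]
    rfl
  rw [e]
  have h : ∀ k, ∑ l, rankOneAt i (b l : H i) (b l) (vecTensor (v k)) = vecTensor (v k) := by
    intro k
    have h1 : (∑ l, InnerProductSpace.rankOne ℂ (b l : H i) (b l : H i)) (v k i) = v k i := by
      have h2 := congrArg (Subtype.val) (b.sum_repr' ⟨v k i, Submodule.subset_span ⟨k, rfl⟩⟩)
      simpa [InnerProductSpace.rankOne_apply] using h2
    simp only [rankOneAt]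
    rw [← sum_apply, ← ampliation_sum, ampliation_vecTensor, h1,
      Function.update_eq_self]
  simp only [map_sum, map_smul]
  rw [Finset.sum_comm]
  simp only [← Finset.smul_sum, h]

/-- Meant for `D` the slice of `C` by the vector state of `ξ`. With `W l = |ξ⟩⟨e l|` one has `D Y =
∑ (W l)* C (W l) Y`; pair this with `D Y`, apply Cauchy-Schwarz to the sum, and use Bessel's
inequality for both `D Y` and `Y`. -/
theorem norm_le_of_rankOneAt_conj (i : ι) {ξ : H i} (hξ : ‖ξ‖ = 1)
    {C D : HilbertTensor H →L[ℂ] HilbertTensor H}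
    (h : ∀ e, rankOneAt i e ξ * C * rankOneAt i ξ e = D * rankOneAt i e e) : ‖D‖ ≤ ‖C‖ := by
  refine D.opNorm_le_bound (norm_nonneg _) fun y => ?_
  induction y using UniformSpace.Completion.induction_on with
  | hp => exact isClosed_le (by fun_prop) (by fun_prop)
  | ih y =>
    obtain ⟨m, e, he, hy⟩ := exists_orthonormal_rankOneAt_sum i y
    generalize (UniformSpace.Completion.coe' y : HilbertTensor H) = Y at hy ⊢
    have h1 : D Y = ∑ l, rankOneAt i (e l) ξ (C (rankOneAt i ξ (e l) Y)) := by
      conv_lhs => rw [← hy, map_sum]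
      exact Finset.sum_congr rfl fun l _ => (DFunLike.congr_fun (h (e l)) Y).symm
    have h2 : ‖D Y‖ ^ 2 ≤ ∑ l, ‖rankOneAt i ξ (e l) (D Y)‖ * (‖C‖ * ‖rankOneAt i ξ (e l) Y‖) := by
      have : ‖D Y‖ ^ 2 = (inner ℂ (D Y) (D Y)).re :=
        InnerProductSpace.norm_sq_eq_re_inner (𝕜 := ℂ) _
      rw [this]
      -- Only the second argument is expanded; the first must survive as `D Y` for Bessel's
      -- inequality.
      conv_lhs => enter [1, 3]; rw [h1]
      rw [inner_sum, Complex.re_sum]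
      refine Finset.sum_le_sum fun l _ => ?_
      rw [← rankOneAt_star i ξ (e l), ContinuousLinearMap.star_eq_adjoint,
        ContinuousLinearMap.adjoint_inner_right]
      exact (re_inner_le_norm (𝕜 := ℂ) _ _).trans
        (mul_le_mul_of_nonneg_left (C.le_opNorm _) (norm_nonneg _))
    have h3 := Real.sum_mul_le_sqrt_mul_sqrt Finset.univ
      (fun l => ‖rankOneAt i ξ (e l) (D Y)‖) (fun l => ‖rankOneAt i ξ (e l) Y‖)
    have h4 : √(∑ l, ‖rankOneAt i ξ (e l) (D Y)‖ ^ 2) ≤ ‖D Y‖ :=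
      Real.sqrt_le_iff.mpr ⟨norm_nonneg _, sum_norm_rankOneAt_sq_le i hξ he _⟩
    have h5 : √(∑ l, ‖rankOneAt i ξ (e l) Y‖ ^ 2) ≤ ‖Y‖ :=
      Real.sqrt_le_iff.mpr ⟨norm_nonneg _, sum_norm_rankOneAt_sq_le i hξ he _⟩
    have h6 : ‖D Y‖ ^ 2 ≤ ‖C‖ * (‖D Y‖ * ‖Y‖) := by
      refine h2.trans ?_
      simp only [mul_left_comm _ ‖C‖, ← Finset.mul_sum]
      exact mul_le_mul_of_nonneg_left
        (h3.trans (mul_le_mul h4 h5 (Real.sqrt_nonneg _) (norm_nonneg _))) (norm_nonneg _)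
    rcases (norm_nonneg (D Y)).eq_or_lt with h0 | h0
    · rw [← h0]; positivity
    · refine le_of_mul_le_mul_left ?_ h0
      linarith

end SliceBound

/-! ### The spatial tensor product, its dense algebraic part, and slice maps. -/

theorem adjoin_le_span {B : Type*} [Ring B] [StarRing B] [Algebra ℂ B] [StarModule ℂ B]
    {s : Set B} (h1 : 1 ∈ s) (hmul : ∀ x ∈ s, ∀ y ∈ s, x * y ∈ s) (hstar : ∀ x ∈ s, star x ∈ s)
    {x : B} (hx : x ∈ StarAlgebra.adjoin ℂ s) : x ∈ Submodule.span ℂ s := by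
  induction hx using StarAlgebra.adjoin_induction with
  | mem x h => exact Submodule.subset_span h
  | algebraMap r =>
    rw [Algebra.algebraMap_eq_smul_one]
    exact Submodule.smul_mem _ _ (Submodule.subset_span h1)
  | add x y _ _ hx hy => exact add_mem hx hy
  | mul x y _ _ hx hy =>
    have h := Submodule.mul_mem_mul hx hy
    rw [Submodule.span_mul_span] at h
    refine Submodule.span_mono ?_ h
    rintro _ ⟨a, ha, b, hb, rfl⟩
    exact hmul a ha b hb
  | star x _ hx =>
    clear * - hx hstar
    induction hx using Submodule.span_induction with
    | mem x h => exact Submodule.subset_span (hstar x h)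
    | zero => simp
    | add x y _ _ hx hy => rw [star_add]; exact add_mem hx hy
    | smul c x _ hx => rw [star_smul]; exact Submodule.smul_mem _ _ hx

section MinTensor

variable {ι : Type*} [Fintype ι] {A : ι → Type*} [∀ i, CStarAlgebra (A i)]
  {H : ι → Type*} [∀ i, NormedAddCommGroup (H i)] [∀ i, InnerProductSpace ℂ (H i)]
  [∀ i, CompleteSpace (H i)] (π : ∀ i, A i →⋆ₐ[ℂ] (H i →L[ℂ] H i))

theorem isClosed_minTensor :
    IsClosed (minTensor π : Set (HilbertTensor H →L[ℂ] HilbertTensor H)) :=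
  StarSubalgebra.isClosed_topologicalClosure _

/-- `⊗ᵢ Aᵢ` as an abstract C*-algebra. -/
abbrev minTensorCStarAlgebra : CStarAlgebra (minTensor π) :=
  StarSubalgebra.cstarAlgebra (minTensor π) (h_closed := isClosed_minTensor π)

theorem coe_elemTensor (a : ∀ i, A i) :
    (elemTensor π a : HilbertTensor H →L[ℂ] HilbertTensor H) = opTensor fun i => π i (a i) := rfl

theorem elemTensor_one : elemTensor π (fun _ => 1) = 1 := by
  refine Subtype.ext ?_
  simp [coe_elemTensor, opTensor_one]

theorem elemTensor_mul (a b : ∀ i, A i) :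
    elemTensor π (fun i => a i * b i) = elemTensor π a * elemTensor π b := by
  refine Subtype.ext ?_
  simp [coe_elemTensor, opTensor_mul]

theorem elemTensor_star (a : ∀ i, A i) :
    elemTensor π (fun i => star (a i)) = star (elemTensor π a) := by
  refine Subtype.ext ?_
  simp [coe_elemTensor, opTensor_star, map_star]

/-- The linear map from the algebraic tensor product `⨂ᵢ Aᵢ` to operators on `⊗ᵢ Hᵢ`. -/
def opOfTensor : PiTensorProduct ℂ A →ₗ[ℂ] (HilbertTensor H →L[ℂ] HilbertTensor H) :=
  PiTensorProduct.lift (opTensorMultilinear.compLinearMap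
    fun i => (π i : A i →ₐ[ℂ] (H i →L[ℂ] H i)).toLinearMap)

theorem opOfTensor_tprod (a : ∀ i, A i) :
    opOfTensor π (PiTensorProduct.tprod ℂ a) = elemTensor π a := by
  rw [opOfTensor, PiTensorProduct.lift.tprod]
  rfl

theorem opOfTensor_mem (t : PiTensorProduct ℂ A) : opOfTensor π t ∈ minTensor π := by
  induction t using PiTensorProduct.induction_on with
  | smul_tprod r f =>
    rw [map_smul, opOfTensor_tprod]
    exact (r • elemTensor π f).2
  | add x y hx hy =>
    rw [map_add]
    exact add_mem hx hy

/-- The linear map from the algebraic tensor product `⨂ᵢ Aᵢ` to `⊗ᵢ Aᵢ`. -/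
def ofTensor : PiTensorProduct ℂ A →ₗ[ℂ] minTensor π :=
  LinearMap.codRestrict (minTensor π).toSubalgebra.toSubmodule (opOfTensor π) (opOfTensor_mem π)

theorem ofTensor_tprod (a : ∀ i, A i) :
    ofTensor π (PiTensorProduct.tprod ℂ a) = elemTensor π a :=
  Subtype.ext (opOfTensor_tprod π a)

theorem denseRange_ofTensor : DenseRange (ofTensor π) := by
  intro a
  rw [Metric.mem_closure_iff]
  intro ε hε
  have ha : (a : HilbertTensor H →L[ℂ] HilbertTensor H) ∈ closure (StarAlgebra.adjoin ℂ
      (Set.range fun a : ∀ i, A i => opTensor fun i => π i (a i)) :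
        Set (HilbertTensor H →L[ℂ] HilbertTensor H)) := a.2
  obtain ⟨b, hb, hab⟩ := Metric.mem_closure_iff.mp ha ε hε
  have hb' := adjoin_le_span (s := Set.range fun a : ∀ i, A i => opTensor fun i => π i (a i))
    ⟨fun _ => 1, by simp [opTensor_one]⟩
    (by rintro _ ⟨x, rfl⟩ _ ⟨y, rfl⟩; exact ⟨fun i => x i * y i, by simp [opTensor_mul]⟩)
    (by rintro _ ⟨x, rfl⟩; exact ⟨fun i => star (x i), by simp [opTensor_star, map_star]⟩) hb
  have hle : Submodule.span ℂ (Set.range fun a : ∀ i, A i => opTensor fun i => π i (a i)) ≤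
      LinearMap.range (opOfTensor π) := by
    rw [Submodule.span_le]
    rintro _ ⟨x, rfl⟩
    exact ⟨_, opOfTensor_tprod π x⟩
  obtain ⟨t, rfl⟩ := hle hb'
  exact ⟨_, ⟨t, rfl⟩, hab⟩

theorem elemTensor_mem_tilde {i : ι} {a : ∀ j, A j} (ha : a i = 1) :
    elemTensor π a ∈ tilde π i :=
  StarSubalgebra.le_topologicalClosure _ (StarAlgebra.subset_adjoin ℂ _ ⟨a, ha, rfl⟩)

theorem tilde_subset_closure_span (i : ι) : (tilde π i : Set (minTensor π)) ⊆
    closure (Submodule.span ℂ {x | ∃ a : ∀ j, A j, a i = 1 ∧ x = elemTensor π a}) := by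
  refine closure_mono fun b hb => adjoin_le_span ?_ ?_ ?_ hb
  · exact ⟨fun _ => 1, rfl, (elemTensor_one π).symm⟩
  · rintro _ ⟨x, hx, rfl⟩ _ ⟨y, hy, rfl⟩
    exact ⟨fun i => x i * y i, by simp [hx, hy], (elemTensor_mul π x y).symm⟩
  · rintro _ ⟨x, hx, rfl⟩
    exact ⟨fun i => star (x i), by simp [hx], (elemTensor_star π x).symm⟩

/-- Reduces vanishing on `Ãᵢ` to a condition on elementary tensors, which for matrix algebras can be
compared with a partial trace. -/
theorem eq_zero_on_tilde_iff (i : ι) (φ : minTensor π →L[ℂ] ℂ) :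
    (∀ c ∈ tilde π i, φ c = 0) ↔ ∀ a : ∀ j, A j, a i = 1 → φ (elemTensor π a) = 0 := by
  refine ⟨fun h a ha => h _ (elemTensor_mem_tilde π ha), fun h c hc => ?_⟩
  have hcl : IsClosed {x | φ x = 0} := isClosed_eq φ.continuous continuous_const
  refine closure_minimal ?_ hcl (tilde_subset_closure_span π i hc)
  intro x hx
  have hle : Submodule.span ℂ {x | ∃ a : ∀ j, A j, a i = 1 ∧ x = elemTensor π a} ≤
      LinearMap.ker φ.toLinearMap := by
    rw [Submodule.span_le]
    rintro _ ⟨a, ha, rfl⟩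
    exact h a ha
  exact hle hx

variable [DecidableEq ι]

/-- The slice map `a ↦ ⟪ξ, π(a) ξ⟫ 1` of a vector state. -/
def vectorSlice {B : Type*} [CStarAlgebra B] {K : Type*} [NormedAddCommGroup K]
    [InnerProductSpace ℂ K] [CompleteSpace K] (π : B →⋆ₐ[ℂ] (K →L[ℂ] K)) (ξ : K) : B →ₗ[ℂ] B where
  toFun a := inner ℂ ξ (π a ξ) • 1
  map_add' a b := by simp [add_smul]
  map_smul' c a := by simp [mul_smul]

theorem vectorSlice_apply {B : Type*} [CStarAlgebra B] {K : Type*} [NormedAddCommGroup K]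
    [InnerProductSpace ℂ K] [CompleteSpace K] (π : B →⋆ₐ[ℂ] (K →L[ℂ] K)) (ξ : K) (a : B) :
    vectorSlice π ξ a = inner ℂ ξ (π a ξ) • 1 := rfl

theorem vectorSlice_one {B : Type*} [CStarAlgebra B] {K : Type*} [NormedAddCommGroup K]
    [InnerProductSpace ℂ K] [CompleteSpace K] (π : B →⋆ₐ[ℂ] (K →L[ℂ] K)) {ξ : K} (hξ : ‖ξ‖ = 1) :
    vectorSlice π ξ 1 = 1 := by
  simp [vectorSlice_apply, inner_self_eq_norm_sq_to_K, hξ]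

/-- The slice maps of vector states, applied in the factors belonging to `s`. -/
def slice (ξ : ∀ i, H i) (s : Finset ι) : PiTensorProduct ℂ A →ₗ[ℂ] PiTensorProduct ℂ A :=
  PiTensorProduct.map fun i => if i ∈ s then vectorSlice (π i) (ξ i) else LinearMap.id

omit [Fintype ι] in
theorem slice_tprod (ξ : ∀ i, H i) (s : Finset ι) (a : ∀ i, A i) :
    slice π ξ s (PiTensorProduct.tprod ℂ a) = PiTensorProduct.tprod ℂ
      fun i => (if i ∈ s then vectorSlice (π i) (ξ i) else LinearMap.id) (a i) :=
  PiTensorProduct.map_tprod _ _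

omit [Fintype ι] in
theorem slice_empty (ξ : ∀ i, H i) (t : PiTensorProduct ℂ A) : slice π ξ ∅ t = t := by
  simp [slice, PiTensorProduct.map_id]

omit [Fintype ι] in
theorem slice_insert (ξ : ∀ i, H i) {s : Finset ι} {i : ι} (hi : i ∉ s) (t : PiTensorProduct ℂ A) :
    slice π ξ (insert i s) t = slice π ξ {i} (slice π ξ s t) := by
  rw [slice, slice, slice, ← LinearMap.comp_apply, ← PiTensorProduct.map_comp]
  congr 2
  funext j
  by_cases hj : j = i
  · subst hj; simp [hi]
  · simp [hj]

theorem slice_univ (ξ : ∀ i, H i) (t : PiTensorProduct ℂ A) :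
    ∃ c : ℂ, ofTensor π (slice π ξ Finset.univ t) = c • 1 := by
  induction t using PiTensorProduct.induction_on with
  | smul_tprod r a =>
    refine ⟨r * ∏ i, inner ℂ (ξ i) (π i (a i) (ξ i)), ?_⟩
    rw [map_smul, slice_tprod]
    simp only [Finset.mem_univ, if_true, vectorSlice_apply]
    rw [(PiTensorProduct.tprod ℂ).map_smul_univ, map_smul, map_smul, ofTensor_tprod,
      elemTensor_one, smul_smul]
  | add x y hx hy =>
    obtain ⟨c, hc⟩ := hx
    obtain ⟨d, hd⟩ := hy
    exact ⟨c + d, by rw [map_add, map_add, hc, hd, add_smul]⟩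

omit [Fintype ι] in
theorem slice_singleton_tprod (ξ : ∀ i, H i) (i : ι) (a : ∀ i, A i) :
    slice π ξ {i} (PiTensorProduct.tprod ℂ a) =
      PiTensorProduct.tprod ℂ (Function.update a i (vectorSlice (π i) (ξ i) (a i))) := by
  rw [slice_tprod]
  congr 1
  funext j
  by_cases hj : j = i
  · subst hj; simp
  · simp [hj]

/-- The criterion `norm_le_of_rankOneAt_conj` is linear in `t`, and on elementary tensors it is the
identity `|e⟩⟨ξ| T |ξ⟩⟨e| = ⟪ξ, T ξ⟫ |e⟩⟨e|` in the `i`-th factor. -/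
theorem norm_ofTensor_slice_le {ξ : ∀ i, H i} (hξ : ∀ i, ‖ξ i‖ = 1) (i : ι)
    (t : PiTensorProduct ℂ A) : ‖ofTensor π (slice π ξ {i} t)‖ ≤ ‖ofTensor π t‖ := by
  change ‖opOfTensor π (slice π ξ {i} t)‖ ≤ ‖opOfTensor π t‖
  refine norm_le_of_rankOneAt_conj i (hξ i) fun e => ?_
  induction t using PiTensorProduct.induction_on with
  | add x y hx hy => rw [map_add, map_add, map_add, mul_add, add_mul, add_mul, hx, hy]
  | smul_tprod r a =>
    rw [map_smul, map_smul, map_smul, mul_smul_comm, smul_mul_assoc, smul_mul_assoc]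
    congr 1
    rw [slice_singleton_tprod, opOfTensor_tprod, opOfTensor_tprod, coe_elemTensor, coe_elemTensor,
      rankOneAt, rankOneAt, rankOneAt, ampliation_mul_opTensor_mul]
    refine continuousLinearMap_ext_vecTensor fun η => ?_
    change _ = opTensor _ (ampliation _ _ _)
    rw [ampliation_vecTensor, opTensor_vecTensor, opTensor_vecTensor, update_apply_apply]
    congr 1
    funext j
    by_cases hj : j = i
    · subst hj
      simp [vectorSlice_apply, InnerProductSpace.rankOne_apply, smul_smul, mul_comm]
    · simp [hj]

/-- The slice maps live on the algebraic tensor product only, so elements of `Ãᵢ` enter the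
estimates through fixed algebraic approximants. -/
theorem exists_slice_fixed_of_mem_tilde {ξ : ∀ i, H i} (hξ : ∀ i, ‖ξ i‖ = 1) {i : ι}
    {c : minTensor π} (hc : c ∈ tilde π i) {ε : ℝ} (hε : 0 < ε) :
    ∃ t, slice π ξ {i} t = t ∧ ‖c - ofTensor π t‖ < ε := by
  obtain ⟨b, hb, hcb⟩ := Metric.mem_closure_iff.mp (tilde_subset_closure_span π i hc) ε hε
  have hle : Submodule.span ℂ {x | ∃ a : ∀ j, A j, a i = 1 ∧ x = elemTensor π a} ≤
      (LinearMap.eqLocus (slice π ξ {i}) LinearMap.id).map (ofTensor π) := by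
    rw [Submodule.span_le]
    rintro _ ⟨a, ha, rfl⟩
    refine ⟨PiTensorProduct.tprod ℂ a, ?_, ofTensor_tprod π a⟩
    rw [SetLike.mem_coe, LinearMap.mem_eqLocus, slice_singleton_tprod, ha,
      vectorSlice_one (π i) (hξ i), ← ha, Function.update_eq_self]
    rfl
  obtain ⟨t, ht, rfl⟩ := hle hb
  exact ⟨t, ht, by rwa [dist_eq_norm] at hcb⟩

/-- Telescoping: adding a factor `i` to `s` contributes `t - Eᵢ t = (1 - Eᵢ)(t - u i)`, of norm at
most `2 ‖t - u i‖`, and applies the contraction `Eᵢ` to the error already present. -/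
theorem norm_sub_slice_le {ξ : ∀ i, H i} (hξ : ∀ i, ‖ξ i‖ = 1) (t : PiTensorProduct ℂ A)
    (u : ι → PiTensorProduct ℂ A) (hu : ∀ i, slice π ξ {i} (u i) = u i) (s : Finset ι) :
    ‖ofTensor π (t - slice π ξ s t)‖ ≤ ∑ i ∈ s, 2 * ‖ofTensor π (t - u i)‖ := by
  induction s using Finset.induction_on with
  | empty => simp [slice_empty]
  | insert i s hi ih =>
    have e : t - slice π ξ (insert i s) t =
        (t - u i) - slice π ξ {i} (t - u i) + slice π ξ {i} (t - slice π ξ s t) := by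
      rw [slice_insert π ξ hi, map_sub, map_sub, hu]
      abel
    rw [e, Finset.sum_insert hi, map_add, map_sub]
    have h1 := norm_ofTensor_slice_le π hξ i (t - u i)
    have h2 := norm_ofTensor_slice_le π hξ i (t - slice π ξ s t)
    refine (norm_add_le _ _).trans ?_
    have h3 := norm_sub_le (ofTensor π (t - u i)) (ofTensor π (slice π ξ {i} (t - u i)))
    linarith

omit [DecidableEq ι] in
theorem norm_sub_le_add_add (a c t u : minTensor π) :
    ‖t - u‖ ≤ ‖a - c‖ + ‖a - t‖ + ‖c - u‖ := by
  have h4 := norm_add_le ((a - c) - (a - t)) (c - u)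
  have h5 := norm_sub_le (a - c) (a - t)
  rw [show (a - c) - (a - t) + (c - u) = t - u by abel] at h4
  linarith

/-- The source of finiteness: `F` kills the scalar left after slicing every factor, so only the
telescoped error contributes. -/
theorem norm_apply_le_sum_dist [∀ i, Nontrivial (H i)] {F : minTensor π →L[ℂ] ℂ} (hF : F 1 = 0)
    {M : ℝ} (hM : 0 ≤ M) (hFM : ∀ a, ‖F a‖ ≤ M * ‖a‖)
    (a : minTensor π) (c : ι → minTensor π) (hc : ∀ i, c i ∈ tilde π i) :
    ‖F a‖ ≤ M * ∑ i, 2 * ‖a - c i‖ := by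
  choose v hv using fun i => exists_ne (0 : H i)
  obtain ⟨ξ, hξ⟩ : ∃ ξ : ∀ i, H i, ∀ i, ‖ξ i‖ = 1 :=
    ⟨fun i => ((‖v i‖ : ℂ)⁻¹) • v i, fun i => norm_smul_inv_norm (hv i)⟩
  -- `M * ε` pays for replacing `a` by an algebraic tensor `t` inside `F`; in each summand `ε + ε`
  -- pays for replacing `a` by `t` and `c i` by `u i`.
  have key : ∀ ε > 0, ‖F a‖ ≤ M * ε + M * ∑ i, (2 * ‖a - c i‖ + 2 * (ε + ε)) := by
    intro ε hε
    obtain ⟨_, ⟨t, rfl⟩, ht⟩ := Metric.mem_closure_iff.mp (denseRange_ofTensor π a) ε hε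
    choose u hu hcu using fun i => exists_slice_fixed_of_mem_tilde π hξ (hc i) hε
    have h1 := norm_sub_slice_le π hξ t u hu Finset.univ
    obtain ⟨z, hz⟩ := slice_univ π ξ t
    have h2 : F a = F (a - ofTensor π t) + F (ofTensor π (t - slice π ξ Finset.univ t)) := by
      rw [map_sub (ofTensor π), hz, map_sub, map_sub, map_smul, hF, smul_zero, sub_zero,
        sub_add_cancel]
    rw [dist_eq_norm] at ht
    have h3 : ∑ i, 2 * ‖ofTensor π (t - u i)‖ ≤ ∑ i, (2 * ‖a - c i‖ + 2 * (ε + ε)) := by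
      refine Finset.sum_le_sum fun i _ => ?_
      have h4 := norm_sub_le_add_add π a (c i) (ofTensor π t) (ofTensor π (u i))
      rw [map_sub]
      linarith [hcu i]
    rw [h2]
    refine (norm_add_le _ _).trans (add_le_add ((hFM _).trans ?_) ((hFM _).trans ?_))
    · exact mul_le_mul_of_nonneg_left ht.le hM
    · exact mul_le_mul_of_nonneg_left (h1.trans h3) hM
  have hlim : Filter.Tendsto (fun ε : ℝ => M * ε + M * ∑ i, (2 * ‖a - c i‖ + 2 * (ε + ε)))
      (nhdsWithin 0 (Set.Ioi 0)) (nhds (M * 0 + M * ∑ i, (2 * ‖a - c i‖ + 2 * ((0 : ℝ) + 0)))) := by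
    refine Filter.Tendsto.mono_left (Continuous.tendsto ?_ 0) nhdsWithin_le_nhds
    exact (continuous_const.mul continuous_id).add (continuous_const.mul (continuous_finsetSum _
      fun i _ => continuous_const.add (continuous_const.mul (continuous_id.add continuous_id))))
  have h := ge_of_tendsto hlim (Filter.eventually_of_mem self_mem_nhdsWithin key)
  simpa only [mul_zero, add_zero, zero_add] using h

omit [DecidableEq ι] in
-- If one `H i` is zero, all elementary vectors vanish and with them the whole algebra. This
-- provides the unit vectors for slicing.
theorem nontrivial_factor [Nontrivial (minTensor π)] (i : ι) : Nontrivial (H i) := by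
  by_contra h
  rw [not_nontrivial_iff_subsingleton] at h
  refine zero_ne_one (α := minTensor π) (Subtype.ext ?_)
  refine continuousLinearMap_ext_vecTensor fun ξ => ?_
  have h0 : vecTensor ξ = 0 := by
    rw [← inner_self_eq_zero (𝕜 := ℂ), inner_vecTensor]
    refine Finset.prod_eq_zero (Finset.mem_univ i) ?_
    rw [Subsingleton.elim (ξ i) 0, inner_zero_left]
  rw [h0, map_zero, map_zero]

end MinTensor

/-! ### Positive functionals on a unital C*-algebra. -/

section Positive

variable {B : Type*} [CStarAlgebra B] {φ : B →L[ℂ] ℂ}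

/-- Positivity at `b + c 1` makes the cross term `c φ(b*) + conj(c) φ(b)` real; `c = 1` and `c = i`
give the two components of the claim. -/
theorem positive_selfAdjoint (hφ : ∀ b, 0 ≤ φ (star b * b)) : IsSelfAdjointFunctional φ := by
  intro b
  have key : ∀ c : ℂ, (c * φ (star b) + starRingEnd ℂ c * φ b).im = 0 := by
    intro c
    have h1 := (Complex.nonneg_iff.mp (hφ (b + c • 1))).2
    have h2 := (Complex.nonneg_iff.mp (hφ b)).2
    have h3 := (Complex.nonneg_iff.mp (hφ 1)).2
    have e : star (b + c • (1 : B)) * (b + c • 1) = star b * b + c • star b +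
        (starRingEnd ℂ c) • b + (starRingEnd ℂ c * c) • (star 1 * 1) := by
      simp only [star_add, star_smul, star_one, add_mul, mul_add, smul_mul_assoc, mul_smul_comm,
        one_mul, mul_one, smul_add, smul_smul, RCLike.star_def, mul_comm c]
      abel
    rw [e] at h1
    simp only [map_add, map_smul, smul_eq_mul, ← Complex.normSq_eq_conj_mul_self, Complex.add_im,
      Complex.im_ofReal_mul] at h1
    rw [Complex.add_im]
    simp only [← h2, ← h3] at h1
    linarith
  have h1 := key 1
  have h2 := key Complex.I
  simp at h1 h2
  apply Complex.ext
  · simp; linarith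
  · simp; linarith

/-- The semi-inner product `⟪x, y⟫ = φ(x* y)` of a positive functional. -/
abbrev positiveCore (hφ : ∀ b, 0 ≤ φ (star b * b)) : PreInnerProductSpace.Core ℂ B where
  inner x y := φ (star x * y)
  conj_inner_symm x y := by
    rw [← positive_selfAdjoint hφ (star x * y), star_mul, star_star]
  re_inner_nonneg x := (Complex.nonneg_iff.mp (hφ x)).1
  add_left x y z := by simp [add_mul]
  smul_left x y r := by simp

theorem positive_norm_sq_le (hφ : ∀ b, 0 ≤ φ (star b * b)) (b : B) :
    ‖φ b‖ ^ 2 ≤ (φ 1).re * (φ (star b * b)).re := by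
  have h := @InnerProductSpace.Core.inner_mul_inner_self_le ℂ B _ _ _ (positiveCore hφ) 1 b
  change ‖φ (star 1 * b)‖ * ‖φ (star b * 1)‖ ≤ (φ (star 1 * 1)).re * (φ (star b * b)).re at h
  rw [star_one, one_mul, mul_one, one_mul] at h
  have h2 : ‖φ (star b)‖ = ‖φ b‖ := by
    rw [← positive_selfAdjoint hφ b, RCLike.norm_conj]
  rwa [h2, ← sq] at h

/-- Cauchy-Schwarz against `1`, combined with `b* b ≤ ‖b‖² 1`, where the difference is written as
`d* d`. -/
theorem positive_norm_le (hφ : ∀ b, 0 ≤ φ (star b * b)) (b : B) :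
    ‖φ b‖ ≤ (φ 1).re * ‖b‖ := by
  let _ := CStarAlgebra.spectralOrder B
  have := CStarAlgebra.spectralOrderedRing B
  have h1 : 0 ≤ (φ 1).re := by
    have := (Complex.nonneg_iff.mp (hφ 1)).1
    rwa [star_one, one_mul] at this
  have h2 : (φ (star b * b)).re ≤ ‖b‖ ^ 2 * (φ 1).re := by
    have h3 : 0 ≤ algebraMap ℝ B (‖b‖ ^ 2) - star b * b :=
      sub_nonneg.mpr CStarAlgebra.star_mul_le_algebraMap_norm_sq
    obtain ⟨d, hd⟩ := CStarAlgebra.nonneg_iff_eq_star_mul_self.mp h3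
    have h4 := (Complex.nonneg_iff.mp (hφ d)).1
    have h5 : algebraMap ℝ B (‖b‖ ^ 2) = ((‖b‖ ^ 2 : ℝ) : ℂ) • (1 : B) := by
      rw [Algebra.algebraMap_eq_smul_one, Complex.coe_smul]
    rw [← hd, h5, map_sub, map_smul, Complex.sub_re, smul_eq_mul, Complex.re_ofReal_mul] at h4
    linarith
  have h3 := positive_norm_sq_le hφ b
  refine abs_le_of_sq_le_sq' ?_ (by positivity) |>.2
  nlinarith

theorem positive_norm_eq (hφ : ∀ b, 0 ≤ φ (star b * b)) : ‖φ‖ = (φ 1).re := by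
  have h1 : 0 ≤ (φ 1).re := by
    have := (Complex.nonneg_iff.mp (hφ 1)).1
    rwa [star_one, one_mul] at this
  refine le_antisymm (φ.opNorm_le_bound h1 (positive_norm_le hφ)) ?_
  rcases subsingleton_or_nontrivial B with hB | hB
  · rw [Subsingleton.elim (1 : B) 0, map_zero]
    exact norm_nonneg _
  · refine (Complex.re_le_norm _).trans ((φ.le_opNorm 1).trans ?_)
    rw [CStarRing.norm_one, mul_one]

theorem positive_apply_one (hφ : ∀ b, 0 ≤ φ (star b * b)) : φ 1 = (φ 1).re := by
  have h := (Complex.nonneg_iff.mp (hφ 1)).2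
  rw [star_one, one_mul] at h
  exact Complex.ext (by simp) (by simp [← h])

theorem isState_iff : IsState φ ↔ (∀ b, 0 ≤ φ (star b * b)) ∧ φ 1 = 1 := by
  refine and_congr_right fun h => ?_
  rw [positive_norm_eq h]
  refine ⟨fun h1 => by rw [positive_apply_one h, h1, Complex.ofReal_one], fun h1 => by simp [h1]⟩

end Positive

section MinTensor

variable {ι : Type*} [Fintype ι] {A : ι → Type*} [∀ i, CStarAlgebra (A i)]
  {H : ι → Type*} [∀ i, NormedAddCommGroup (H i)] [∀ i, InnerProductSpace ℂ (H i)]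
  [∀ i, CompleteSpace (H i)] (π : ∀ i, A i →⋆ₐ[ℂ] (H i →L[ℂ] H i))

theorem isState_minTensor_iff {φ : minTensor π →L[ℂ] ℂ} :
    IsState φ ↔ (∀ b, 0 ≤ φ (star b * b)) ∧ φ 1 = 1 :=
  @isState_iff (minTensor π) (minTensorCStarAlgebra π) _

theorem minTensor_positive_norm_le {φ : minTensor π →L[ℂ] ℂ} (h : ∀ b, 0 ≤ φ (star b * b))
    (b : minTensor π) : ‖φ b‖ ≤ (φ 1).re * ‖b‖ :=
  @positive_norm_le (minTensor π) (minTensorCStarAlgebra π) _ h b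

theorem minTensor_positive_selfAdjoint {φ : minTensor π →L[ℂ] ℂ} (h : ∀ b, 0 ≤ φ (star b * b)) :
    IsSelfAdjointFunctional φ :=
  @positive_selfAdjoint (minTensor π) (minTensorCStarAlgebra π) _ h

end MinTensor

/-! ### Hahn-Banach splitting of a functional over several quotients. -/

section Abstract

variable {ι : Type*} [Fintype ι]

/-- The choices in different summands are independent, so they can be replaced by suprema one index
at a time. -/
theorem sum_iSup_le_of_forall {α : ι → Type*} [∀ i, Nonempty (α i)] (f : ∀ i, α i → ℝ≥0∞)
    {d : ℝ≥0∞} (h : ∀ a : ∀ i, α i, ∑ i, f i (a i) ≤ d) : ∑ i, ⨆ a, f i a ≤ d := by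
  classical
  have key : ∀ s : Finset ι, ∀ a : ∀ i, α i, ∑ i ∈ s, (⨆ b, f i b) + ∑ i ∈ sᶜ, f i (a i) ≤ d := by
    intro s
    induction s using Finset.induction_on with
    | empty => simpa using h
    | insert i s hi ih =>
      intro a
      rw [Finset.sum_insert hi, add_assoc, ENNReal.iSup_add]
      refine iSup_le fun b => le_trans (le_of_eq ?_) (ih (Function.update a i b))
      have h1 : sᶜ = insert i (insert i s)ᶜ := by
        ext j
        by_cases hj : j = i <;> simp [hj, hi]
      rw [h1, Finset.sum_insert (by simp), Function.update_self, add_left_comm]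
      congr 2
      refine Finset.sum_congr rfl fun j hj => ?_
      rw [Function.update_of_ne]
      rintro rfl
      simp at hj
  simpa using key Finset.univ fun i => Classical.arbitrary _

variable {E : Type*} [SeminormedAddCommGroup E] [NormedSpace ℂ E]

theorem infDist_smul (S : Submodule ℂ E) (c : ℂ) (a : E) :
    Metric.infDist (c • a) S = ‖c‖ * Metric.infDist a S := by
  have h : ∀ x : E, Metric.infDist x S = ‖(Submodule.Quotient.mk x : E ⧸ S)‖ := fun x =>
    (QuotientAddGroup.norm_mk (S := S.toAddSubgroup) x).symm
  rw [h, h, Submodule.Quotient.mk_smul, norm_smul]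

/-- A functional dominated by the maximum of the distances to the subspaces `S i` is a sum of
functionals vanishing on the `S i`, with the dual bound. -/
theorem exists_sum_eq_of_le_infDist [DecidableEq ι] (S : ι → Submodule ℂ E) (F : E →L[ℂ] ℂ) {D : ℝ}
    (hD : 0 ≤ D) (hF : ∀ a r, 0 ≤ r → (∀ i, Metric.infDist a (S i) ≤ r) → ‖F a‖ ≤ D * r) :
    ∃ φ : ι → E →L[ℂ] ℂ, (∀ i, ∀ c ∈ S i, φ i c = 0) ∧ F = ∑ i, φ i ∧
      ∀ (a : ι → E) (r : ℝ), 0 ≤ r → (∀ i, Metric.infDist (a i) (S i) ≤ r) →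
        ∑ i, ‖φ i (a i)‖ ≤ D * r := by
  have hn : ∀ i (x : E), ‖(Submodule.Quotient.mk x : E ⧸ S i)‖ = Metric.infDist x (S i) :=
    fun i x => QuotientAddGroup.norm_mk (S := (S i).toAddSubgroup) x
  -- The product carries the sup norm, so `‖q a‖` is the largest of the distances from `a` to the `S
  -- i`.
  let q : E →ₗ[ℂ] (∀ i, E ⧸ S i) := LinearMap.pi fun i => (S i).mkQ
  have hq : ∀ a, ‖F a‖ ≤ D * ‖q a‖ := fun a => hF a _ (norm_nonneg _) fun i => by
    rw [← hn]
    exact norm_le_pi_norm (q a) i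
  -- By `hq`, `F` vanishes on the kernel of `q`. The factor `h` is only algebraic; its bound `D`
  -- holds on the range of `q`, which is where Hahn-Banach starts.
  obtain ⟨h, hh⟩ : ∃ h : (∀ i, E ⧸ S i) →ₗ[ℂ] ℂ, h ∘ₗ q = F.toLinearMap := by
    have : F.toLinearMap ∈ LinearMap.range q.dualMap := by
      rw [LinearMap.range_dualMap_eq_dualAnnihilator_ker, Submodule.mem_dualAnnihilator]
      intro a ha
      have h1 := hq a
      rw [LinearMap.mem_ker.mp ha, norm_zero, mul_zero] at h1
      exact norm_le_zero_iff.mp h1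
    exact this
  have hh' : ∀ a, h (q a) = F a := fun a => DFunLike.congr_fun hh a
  let f : StrongDual ℂ (LinearMap.range q) := (h.domRestrict (LinearMap.range q)).mkContinuous D (by
    rintro ⟨_, a, rfl⟩
    change ‖h (q a)‖ ≤ D * ‖q a‖
    rw [hh']
    exact hq a)
  have hf : ‖f‖ ≤ D := LinearMap.mkContinuous_norm_le _ hD _
  obtain ⟨g, hg, hgn⟩ := exists_extension_norm_eq (LinearMap.range q) f
  have hgD : ∀ x, ‖g x‖ ≤ D * ‖x‖ := fun x => (g.le_opNorm x).trans
    (mul_le_mul_of_nonneg_right (hgn.trans_le hf) (norm_nonneg _))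
  let φ : ι → E →L[ℂ] ℂ := fun i =>
    (g.toLinearMap ∘ₗ LinearMap.single ℂ (fun i => E ⧸ S i) i ∘ₗ (S i).mkQ).mkContinuous D (by
      intro a
      refine (hgD _).trans (mul_le_mul_of_nonneg_left ?_ hD)
      change ‖(Pi.single i (Submodule.Quotient.mk a) : ∀ i, E ⧸ S i)‖ ≤ ‖a‖
      refine (pi_norm_le_iff_of_nonneg (norm_nonneg a)).mpr fun j => ?_
      by_cases hj : j = i
      · subst hj
        rw [Pi.single_eq_same]
        exact Submodule.Quotient.norm_mk_le _ _
      · rw [Pi.single_eq_of_ne hj, norm_zero]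
        exact norm_nonneg a)
  have hφ : ∀ i a, φ i a = g (Pi.single i (Submodule.Quotient.mk a)) := fun i a => rfl
  refine ⟨φ, fun i c hc => ?_, ?_, fun a r hr ha => ?_⟩
  · rw [hφ, (Submodule.Quotient.mk_eq_zero _).mpr hc, Pi.single_zero, map_zero]
  · ext a
    rw [sum_apply]
    simp only [hφ]
    rw [← map_sum, Finset.univ_sum_single (fun i => (Submodule.Quotient.mk a : E ⧸ S i)), ← hh' a]
    exact (hg ⟨q a, a, rfl⟩).symm
  -- Rotating each `a i` by a phase makes all `φ i (θ i • a i)` nonnegative without changing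
  -- distances, so the sum of absolute values is a single value of `g` on a family of sup norm at
  -- most `r`.
  · have hθ : ∀ z : ℂ, ∃ θ : ℂ, ‖θ‖ = 1 ∧ θ * z = ‖z‖ := by
      intro z
      rcases eq_or_ne z 0 with rfl | hz
      · exact ⟨1, by simp, by simp⟩
      · refine ⟨starRingEnd ℂ z / ‖z‖, ?_, ?_⟩
        · simp [hz]
        · rw [div_mul_eq_mul_div, mul_comm, Complex.mul_conj, Complex.normSq_eq_norm_sq]
          have : (‖z‖ : ℂ) ≠ 0 := by simpa using hz
          field_simp
          push_cast
          ring
    choose θ hθ1 hθ2 using fun i => hθ (φ i (a i))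
    let x : ∀ i, E ⧸ S i := fun i => Submodule.Quotient.mk (θ i • a i)
    have h1 : ((∑ i, ‖φ i (a i)‖ : ℝ) : ℂ) = g x := by
      rw [← Finset.univ_sum_single x, map_sum, Complex.ofReal_sum]
      refine Finset.sum_congr rfl fun i _ => ?_
      rw [← hφ, map_smul, smul_eq_mul, hθ2]
    have h2 : ‖x‖ ≤ r := (pi_norm_le_iff_of_nonneg hr).mpr fun i => by
      rw [hn, infDist_smul, hθ1, one_mul]
      exact ha i
    have h3 := (hgD x).trans (mul_le_mul_of_nonneg_left h2 hD)
    rw [← h1, Complex.norm_real, Real.norm_of_nonneg (by positivity)] at h3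
    exact h3

end Abstract

/-! ### Finiteness and duality for the quantum Hamming distance. -/

section MinTensor

variable {ι : Type*} [Fintype ι] {A : ι → Type*} [∀ i, CStarAlgebra (A i)]
  {H : ι → Type*} [∀ i, NormedAddCommGroup (H i)] [∀ i, InnerProductSpace ℂ (H i)]
  [∀ i, CompleteSpace (H i)] (π : ∀ i, A i →⋆ₐ[ℂ] (H i →L[ℂ] H i))

/-- The subspace of `⊗ⱼ Aⱼ` underlying `Ãᵢ`. -/
def tildeSubmodule (i : ι) : Submodule ℂ (minTensor π) :=
  (tilde π i).toSubalgebra.toSubmodule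

theorem partialL_eq_infDist (i : ι) (a : minTensor π) :
    partialL π i a = 2 * Metric.infDist a (tildeSubmodule π i) := by
  rw [partialL, Metric.infDist_eq_iInf]
  simp only [dist_eq_norm]
  rfl

theorem partialL_le (i : ι) (a : minTensor π) {c : minTensor π} (hc : c ∈ tilde π i) :
    partialL π i a ≤ 2 * ‖a - c‖ := by
  rw [partialL_eq_infDist, ← dist_eq_norm]
  exact mul_le_mul_of_nonneg_left (Metric.infDist_le_dist_of_mem hc) zero_le_two

theorem partialL_nonneg (i : ι) (a : minTensor π) : 0 ≤ partialL π i a := by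
  rw [partialL_eq_infDist]
  exact mul_nonneg zero_le_two Metric.infDist_nonneg

theorem exists_mem_tilde_of_partialL_lt {i : ι} {a : minTensor π} {r : ℝ}
    (h : partialL π i a < 2 * r) : ∃ c ∈ tilde π i, ‖a - c‖ < r := by
  rw [partialL_eq_infDist] at h
  obtain ⟨c, hc, hac⟩ := (Metric.infDist_lt_iff ⟨0, zero_mem _⟩).mp (lt_of_mul_lt_mul_left h zero_le_two)
  exact ⟨c, hc, by rwa [dist_eq_norm] at hac⟩

theorem norm_star_sub_star (a c : minTensor π) : ‖star a - star c‖ = ‖a - c‖ := by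
  rw [← star_sub]
  exact norm_star ((a - c : minTensor π) : HilbertTensor H →L[ℂ] HilbertTensor H)

theorem partialL_star_le (i : ι) (a : minTensor π) : partialL π i (star a) ≤ partialL π i a := by
  refine le_of_forall_gt_imp_ge_of_dense fun r hr => ?_
  obtain ⟨c, hc, hac⟩ := exists_mem_tilde_of_partialL_lt π (i := i) (a := a) (r := r / 2) (by linarith)
  have h := partialL_le π i (star a) (star_mem hc)
  rw [norm_star_sub_star] at h
  linarith

theorem hammingL_le_one_iff (a : minTensor π) : hammingL π a ≤ 1 ↔ ∀ i, partialL π i a ≤ 1 :=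
  ⟨fun h i => (le_ciSup (Set.finite_range _).bddAbove i).trans h,
    -- This also covers an empty index set, where the real supremum is `0`.
    fun h => Real.iSup_le h zero_le_one⟩

theorem partialL_zero (i : ι) : partialL π i 0 = 0 :=
  le_antisymm ((partialL_le π i 0 (zero_mem _)).trans (by simp)) (partialL_nonneg π i 0)

theorem hammingDist_le_sum_dualNorm {μ ν : minTensor π →L[ℂ] ℂ} {φ : ι → minTensor π →L[ℂ] ℂ}
    (h : μ - ν = ∑ i, φ i) : hammingDist π μ ν ≤ ∑ i, dualNorm π i (φ i) := by
  refine iSup₂_le fun a ha => ?_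
  have h1 : μ a - ν a = ∑ i, φ i a := by rw [← sum_apply, ← h]; rfl
  rw [h1]
  calc ENNReal.ofReal ‖∑ i, φ i a‖ ≤ ENNReal.ofReal (∑ i, ‖φ i a‖) :=
        ENNReal.ofReal_le_ofReal (norm_sum_le _ _)
    _ = ∑ i, ENNReal.ofReal ‖φ i a‖ := ENNReal.ofReal_sum_of_nonneg fun _ _ => norm_nonneg _
    _ ≤ _ := Finset.sum_le_sum fun i _ =>
        le_iSup₂_of_le a ((hammingL_le_one_iff π a).mp ha i) le_rfl

theorem hammingDist_ne_top {μ ν : minTensor π →L[ℂ] ℂ} (hμ : IsState μ) (hν : IsState ν) :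
    hammingDist π μ ν ≠ ⊤ := by
  classical
  obtain ⟨hμp, hμ1⟩ := (isState_minTensor_iff π).mp hμ
  obtain ⟨hνp, hν1⟩ := (isState_minTensor_iff π).mp hν
  have : Nontrivial (minTensor π) := by
    refine ⟨1, 0, fun h => ?_⟩
    rw [h, map_zero] at hμ1
    exact zero_ne_one hμ1
  have : ∀ i, Nontrivial (H i) := nontrivial_factor π
  have hF1 : (μ - ν) 1 = 0 := by rw [sub_apply, hμ1, hν1, sub_self]
  have hF2 : ∀ a, ‖(μ - ν) a‖ ≤ 2 * ‖a‖ := by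
    intro a
    have h1 := minTensor_positive_norm_le π hμp a
    have h2 := minTensor_positive_norm_le π hνp a
    rw [hμ1, Complex.one_re] at h1
    rw [hν1, Complex.one_re] at h2
    rw [sub_apply]
    linarith [norm_sub_le (μ a) (ν a)]
  -- The outer `2` bounds the norm of `μ - ν`. Since `Lᵢ(a) ≤ 1 < 2`, some element of `Ãᵢ` lies
  -- within distance `1` of `a`, whence the summands `2 * 1`.
  refine ne_top_of_le_ne_top (ENNReal.ofReal_ne_top (r := 2 * ∑ _i : ι, 2 * 1)) ?_
  refine iSup₂_le fun a ha => ENNReal.ofReal_le_ofReal ?_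
  choose c hc hac using fun i => exists_mem_tilde_of_partialL_lt π (i := i) (a := a) (r := 1)
    (((hammingL_le_one_iff π a).mp ha i).trans_lt (by norm_num))
  refine (norm_apply_le_sum_dist π hF1 zero_le_two hF2 a c hc).trans ?_
  gcongr with i
  exact (hac i).le

/-- The functional `φ*(a) = conj φ(a*)`. -/
def adjointFunctional (φ : minTensor π →L[ℂ] ℂ) : minTensor π →L[ℂ] ℂ where
  toFun a := starRingEnd ℂ (φ (star a))
  map_add' a b := by simp
  map_smul' c a := by simp
  cont := by
    refine Complex.continuous_conj.comp (φ.continuous.comp ?_)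
    exact Continuous.subtype_mk (continuous_star.comp continuous_subtype_val) _

/-- The self-adjoint part of a functional. -/
def selfAdjointPartFunctional (φ : minTensor π →L[ℂ] ℂ) : minTensor π →L[ℂ] ℂ :=
  (2⁻¹ : ℂ) • (φ + adjointFunctional π φ)

theorem selfAdjointPartFunctional_apply (φ : minTensor π →L[ℂ] ℂ) (a : minTensor π) :
    selfAdjointPartFunctional π φ a = 2⁻¹ * (φ a + starRingEnd ℂ (φ (star a))) := rfl

theorem isSelfAdjointFunctional_selfAdjointPart (φ : minTensor π →L[ℂ] ℂ) :
    IsSelfAdjointFunctional (selfAdjointPartFunctional π φ) := by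
  intro b
  simp only [selfAdjointPartFunctional_apply, star_star, map_mul, map_add, RCLike.conj_conj,
    map_inv₀, Complex.conj_ofNat]
  rw [add_comm]

/-- The unit ball of `Lᵢ` is stable under the involution, and the self-adjoint part averages a value
at `a` with a conjugated value at `star a`. -/
theorem dualNorm_selfAdjointPart_le (i : ι) (φ : minTensor π →L[ℂ] ℂ) :
    dualNorm π i (selfAdjointPartFunctional π φ) ≤ dualNorm π i φ := by
  refine iSup₂_le fun a ha => ?_
  have h1 : ENNReal.ofReal ‖φ a‖ ≤ dualNorm π i φ := le_iSup₂_of_le a ha le_rfl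
  have h2 : ENNReal.ofReal ‖φ (star a)‖ ≤ dualNorm π i φ :=
    le_iSup₂_of_le (star a) ((partialL_star_le π i a).trans ha) le_rfl
  have h3 : ‖selfAdjointPartFunctional π φ a‖ ≤ max ‖φ a‖ ‖φ (star a)‖ := by
    rw [selfAdjointPartFunctional_apply, norm_mul, norm_inv, Complex.norm_two]
    have h4 := norm_add_le (φ a) (starRingEnd ℂ (φ (star a)))
    rw [RCLike.norm_conj] at h4
    have h5 := le_max_left ‖φ a‖ ‖φ (star a)‖
    have h6 := le_max_right ‖φ a‖ ‖φ (star a)‖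
    linarith
  refine (ENNReal.ofReal_le_ofReal h3).trans ?_
  rcases max_choice ‖φ a‖ ‖φ (star a)‖ with h | h <;> rw [h] <;> assumption

theorem norm_sub_apply_le_of_infDist_le {μ ν : minTensor π →L[ℂ] ℂ}
    (hfin : hammingDist π μ ν ≠ ⊤) (a : minTensor π) {r : ℝ} (hr : 0 ≤ r)
    (ha : ∀ i, Metric.infDist a (tildeSubmodule π i) ≤ r) :
    ‖(μ - ν) a‖ ≤ 2 * (hammingDist π μ ν).toReal * r := by
  -- A radius `s > r` is positive even when `r = 0`, so `a` can be rescaled by `(2 * s)⁻¹` into the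
  -- unit ball; afterwards `s` tends to `r`.
  have key : ∀ s, r < s → ‖(μ - ν) a‖ ≤ 2 * (hammingDist π μ ν).toReal * s := by
    intro s hs
    have hs0 : 0 < s := hr.trans_lt hs
    have hcs : ‖(((2 * s)⁻¹ : ℝ) : ℂ)‖ = (2 * s)⁻¹ := by
      rw [Complex.norm_real, Real.norm_of_nonneg (by positivity)]
    have h1 : hammingL π ((((2 * s)⁻¹ : ℝ) : ℂ) • a) ≤ 1 := by
      rw [hammingL_le_one_iff]
      intro i
      rw [partialL_eq_infDist, infDist_smul, hcs]
      calc 2 * ((2 * s)⁻¹ * Metric.infDist a (tildeSubmodule π i)) ≤ 2 * ((2 * s)⁻¹ * s) := by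
            gcongr
            exact (ha i).trans hs.le
        _ = 1 := by field_simp
    have h2 : ENNReal.ofReal ‖(μ - ν) ((((2 * s)⁻¹ : ℝ) : ℂ) • a)‖ ≤ hammingDist π μ ν :=
      le_iSup₂_of_le (f := fun a (_ : hammingL π a ≤ 1) => ENNReal.ofReal ‖μ a - ν a‖) _ h1 le_rfl
    rw [ENNReal.ofReal_le_iff_le_toReal hfin, map_smul, norm_smul, hcs, inv_mul_le_iff₀ (by positivity)] at h2
    linarith
  have hlim : Filter.Tendsto (fun s : ℝ => 2 * (hammingDist π μ ν).toReal * s)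
      (nhdsWithin r (Set.Ioi r)) (nhds (2 * (hammingDist π μ ν).toReal * r)) :=
    ((continuous_const.mul continuous_id).tendsto r).mono_left nhdsWithin_le_nhds
  exact ge_of_tendsto hlim (Filter.eventually_of_mem self_mem_nhdsWithin key)

theorem sub_apply_eq_sum_selfAdjointPart {μ ν : minTensor π →L[ℂ] ℂ} (hμ : IsState μ)
    (hν : IsState ν) {φ : ι → minTensor π →L[ℂ] ℂ} (h : μ - ν = ∑ i, φ i) (a : minTensor π) :
    (μ - ν) a = (∑ i, selfAdjointPartFunctional π (φ i)) a := by
  have h1 : ∀ b, μ b - ν b = ∑ i, φ i b := fun b => by rw [← sum_apply, ← h]; rfl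
  have hsa : starRingEnd ℂ (μ (star a) - ν (star a)) = μ a - ν a := by
    rw [map_sub, minTensor_positive_selfAdjoint π hμ.1 a,
      minTensor_positive_selfAdjoint π hν.1 a]
  rw [sum_apply]
  simp only [selfAdjointPartFunctional_apply]
  rw [← Finset.mul_sum, Finset.sum_add_distrib, ← map_sum, ← h1, ← h1, hsa]
  change μ a - ν a = _
  ring

/-- The splitting theorem supplies a decomposition attaining the infimum. The condition `Lᵢ ≤ 1`
means distance at most `1 / 2`, which cancels the `2` in `D`. -/
theorem exists_decomposition {μ ν : minTensor π →L[ℂ] ℂ} (hμ : IsState μ) (hν : IsState ν) :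
    ∃ φ : ι → minTensor π →L[ℂ] ℂ,
      ((∀ i, (∀ c ∈ tilde π i, φ i c = 0) ∧ IsSelfAdjointFunctional (φ i)) ∧ μ - ν = ∑ i, φ i) ∧
        ∑ i, dualNorm π i (φ i) ≤ hammingDist π μ ν := by
  classical
  have hfin := hammingDist_ne_top π hμ hν
  obtain ⟨φ, hφ0, hφs, hφn⟩ := exists_sum_eq_of_le_infDist (tildeSubmodule π) (μ - ν)
    (D := 2 * (hammingDist π μ ν).toReal) (by positivity)
    fun a r hr ha => norm_sub_apply_le_of_infDist_le π hfin a hr ha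
  refine ⟨fun i => selfAdjointPartFunctional π (φ i), ⟨fun i => ⟨fun c hc => ?_,
    isSelfAdjointFunctional_selfAdjointPart π (φ i)⟩, ?_⟩, ?_⟩
  · rw [selfAdjointPartFunctional_apply, hφ0 i c hc, hφ0 i _ (star_mem (s := tilde π i) hc)]
    simp
  · refine ContinuousLinearMap.ext fun a => ?_
    exact sub_apply_eq_sum_selfAdjointPart π hμ hν hφs a
  · refine (Finset.sum_le_sum fun i _ => dualNorm_selfAdjointPart_le π i (φ i)).trans ?_
    have h1 : ∀ i, dualNorm π i (φ i) =
        ⨆ a : {a : minTensor π // partialL π i a ≤ 1}, ENNReal.ofReal ‖φ i a‖ := fun i => iSup_subtype'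
    simp only [h1]
    have : ∀ i, Nonempty {a : minTensor π // partialL π i a ≤ 1} :=
      fun i => ⟨0, (partialL_zero π i).trans_le zero_le_one⟩
    refine sum_iSup_le_of_forall _ fun a => ?_
    rw [← ENNReal.ofReal_sum_of_nonneg fun _ _ => norm_nonneg _,
      ENNReal.ofReal_le_iff_le_toReal hfin]
    refine (hφn (fun i => a i) (1 / 2) (by norm_num) fun i => ?_).trans_eq (by ring)
    have h2 := (a i).2
    rw [partialL_eq_infDist] at h2
    linarith

/-- Duality for the quantum Hamming distance on states. -/
theorem hammingDist_eq_iInf {μ ν : minTensor π →L[ℂ] ℂ} (hμ : IsState μ) (hν : IsState ν) :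
    hammingDist π μ ν = ⨅ (φ : ι → (minTensor π →L[ℂ] ℂ))
      (_ : (∀ i, (∀ c ∈ tilde π i, φ i c = 0) ∧ IsSelfAdjointFunctional (φ i)) ∧
        μ - ν = ∑ i, φ i), ∑ i, dualNorm π i (φ i) := by
  refine le_antisymm (le_iInf₂ fun φ hφ => hammingDist_le_sum_dualNorm π hφ.2) ?_
  obtain ⟨φ, hφ, hle⟩ := exists_decomposition π hμ hν
  exact iInf₂_le_of_le φ hφ hle

end MinTensor

/-! ### Trace norm of Hermitian matrices. -/

section TraceNorm

variable {n : Type*} [Fintype n] [DecidableEq n] {X : Matrix n n ℂ}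

/-- Functional calculus of a Hermitian matrix, for arbitrary real functions. -/
def hermitianCalculus (hX : X.IsHermitian) (f : ℝ → ℝ) : Matrix n n ℂ :=
  Unitary.conjStarAlgAut ℂ _ hX.eigenvectorUnitary
    (Matrix.diagonal fun k => ((f (hX.eigenvalues k) : ℝ) : ℂ))

theorem hermitianCalculus_mul (hX : X.IsHermitian) (f g : ℝ → ℝ) :
    hermitianCalculus hX f * hermitianCalculus hX g = hermitianCalculus hX fun x => f x * g x := by
  simp only [hermitianCalculus, ← map_mul, Matrix.diagonal_mul_diagonal, Complex.ofReal_mul]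

theorem hermitianCalculus_sub (hX : X.IsHermitian) (f g : ℝ → ℝ) :
    hermitianCalculus hX f - hermitianCalculus hX g = hermitianCalculus hX fun x => f x - g x := by
  simp only [hermitianCalculus, ← map_sub, Matrix.diagonal_sub, Complex.ofReal_sub]

theorem hermitianCalculus_one (hX : X.IsHermitian) : hermitianCalculus hX (fun _ => 1) = 1 := by
  simp [hermitianCalculus]

theorem hermitianCalculus_id (hX : X.IsHermitian) : hermitianCalculus hX (fun x => x) = X :=
  hX.spectral_theorem.symm

theorem isHermitian_hermitianCalculus (hX : X.IsHermitian) (f : ℝ → ℝ) :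
    (hermitianCalculus hX f).IsHermitian := by
  change star _ = _
  rw [hermitianCalculus, ← map_star]
  congr 1
  rw [Matrix.star_eq_conjTranspose, Matrix.diagonal_conjTranspose]
  congr 1
  funext k
  simp

theorem posSemidef_hermitianCalculus (hX : X.IsHermitian) {f : ℝ → ℝ} (hf : ∀ x, 0 ≤ f x) :
    (hermitianCalculus hX f).PosSemidef := by
  have h : hermitianCalculus hX f =
      (hermitianCalculus hX fun x => √(f x)).conjTranspose * hermitianCalculus hX fun x => √(f x) := by
    rw [(isHermitian_hermitianCalculus hX _).eq, hermitianCalculus_mul]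
    simp only [Real.mul_self_sqrt (hf _)]
  rw [h]
  exact Matrix.posSemidef_conjTranspose_mul_self _

theorem trace_hermitianCalculus (hX : X.IsHermitian) (f : ℝ → ℝ) :
    (hermitianCalculus hX f).trace = ((∑ k, f (hX.eigenvalues k) : ℝ) : ℂ) := by
  rw [hermitianCalculus, Unitary.conjStarAlgAut_apply, Matrix.trace_mul_cycle,
    Unitary.coe_star_mul_self, one_mul, Matrix.trace_diagonal, Complex.ofReal_sum]

theorem charpoly_hermitianCalculus (hX : X.IsHermitian) (f : ℝ → ℝ) :
    (hermitianCalculus hX f).charpoly =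
      ∏ k, (Polynomial.X - Polynomial.C ((f (hX.eigenvalues k) : ℝ) : ℂ)) := by
  rw [hermitianCalculus, Unitary.conjStarAlgAut_apply, Matrix.charpoly_mul_comm, ← mul_assoc,
    Unitary.coe_star_mul_self, one_mul, Matrix.charpoly_diagonal]

/-- `Xᴴ X = X²` has two diagonalizations whose eigenvalues may be enumerated differently; comparing
roots of the characteristic polynomial identifies them as multisets, and summing square roots
ignores the order. -/
theorem traceNorm_eq_sum_abs_eigenvalues (hX : X.IsHermitian) :
    traceNorm X = ∑ k, |hX.eigenvalues k| := by
  have h1 : X.conjTranspose * X = hermitianCalculus hX fun x => x * x := by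
    rw [← hermitianCalculus_mul, hermitianCalculus_id, hX.eq]
  have hY := Matrix.isHermitian_conjTranspose_mul_self X
  have hY' := charpoly_hermitianCalculus hY fun x => x
  rw [hermitianCalculus_id] at hY'
  have h2 := charpoly_hermitianCalculus hX fun x => x * x
  rw [← h1, hY'] at h2
  have h3 := congrArg Polynomial.roots h2
  have hroots : ∀ g : n → ℂ, (∏ k, (Polynomial.X - Polynomial.C (g k))).roots =
      Finset.univ.val.map g := fun g => by
    rw [← Polynomial.roots_multiset_prod_X_sub_C (Finset.univ.val.map g), Multiset.map_map]
    rfl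
  rw [hroots, hroots] at h3
  have h4 := congrArg (fun s : Multiset ℂ => (s.map fun z => √z.re).sum) h3
  simp only [Multiset.map_map, Function.comp_def, Complex.ofReal_re, Real.sqrt_mul_self_eq_abs] at h4
  exact h4

/-- Jordan decomposition into the positive and negative parts. -/
theorem exists_posSemidef_sub_eq (hX : X.IsHermitian) : ∃ P N : Matrix n n ℂ,
    P.PosSemidef ∧ N.PosSemidef ∧ X = P - N ∧ ((traceNorm X : ℝ) : ℂ) = P.trace + N.trace := by
  refine ⟨hermitianCalculus hX fun x => max x 0, hermitianCalculus hX fun x => max (-x) 0,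
    posSemidef_hermitianCalculus hX fun x => le_max_right _ _,
    posSemidef_hermitianCalculus hX fun x => le_max_right _ _, ?_, ?_⟩
  · rw [hermitianCalculus_sub]
    conv_lhs => rw [← hermitianCalculus_id hX]
    congr 1
    funext x
    rcases le_total 0 x with h | h <;> simp [h]
  · rw [trace_hermitianCalculus, trace_hermitianCalculus, ← Complex.ofReal_add,
      ← Finset.sum_add_distrib, traceNorm_eq_sum_abs_eigenvalues hX]
    congr 1
    refine Finset.sum_congr rfl fun k _ => ?_
    rcases le_total 0 (hX.eigenvalues k) with h | h <;> simp [h, abs_of_nonneg, abs_of_nonpos]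

theorem exists_symmetry_trace_eq (hX : X.IsHermitian) : ∃ S : Matrix n n ℂ,
    S.IsHermitian ∧ S * S = 1 ∧ (X * S).trace = ((traceNorm X : ℝ) : ℂ) := by
  classical
  -- The sign of `X`, with value `1` rather than `0` at zero so that `S * S = 1` even if `X` is
  -- singular.
  refine ⟨hermitianCalculus hX fun x => if 0 ≤ x then 1 else -1,
    isHermitian_hermitianCalculus hX _, ?_, ?_⟩
  · rw [hermitianCalculus_mul, ← hermitianCalculus_one hX]
    congr 1
    funext x
    split_ifs <;> simp
  · conv_lhs => enter [1, 1]; rw [← hermitianCalculus_id hX]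
    rw [hermitianCalculus_mul, trace_hermitianCalculus, traceNorm_eq_sum_abs_eigenvalues hX]
    congr 1
    refine Finset.sum_congr rfl fun k _ => ?_
    split_ifs with h
    · rw [mul_one, abs_of_nonneg h]
    · rw [mul_neg_one, abs_of_neg (not_le.mp h)]

theorem traceNorm_nonneg (X : Matrix n n ℂ) : 0 ≤ traceNorm X :=
  Finset.sum_nonneg fun _ _ => Real.sqrt_nonneg _

/-- Since `(1 - S)² = 2 (1 - S)`, the trace of `P (1 - S)` is half that of `(1 - S) P (1 - S)`,
which is positive semidefinite. -/
theorem trace_mul_symmetry_re_le {P S : Matrix n n ℂ} (hP : P.PosSemidef) (hS : S.IsHermitian)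
    (hS2 : S * S = 1) : (P * S).trace.re ≤ P.trace.re := by
  have h1 : (1 - S) * (1 - S) = (2 : ℂ) • (1 - S) := by
    rw [sub_mul, mul_sub, mul_sub, hS2, one_mul, mul_one, one_mul, two_smul]
    abel
  have h2 : (1 - S).conjTranspose = 1 - S := by
    rw [Matrix.conjTranspose_sub, Matrix.conjTranspose_one, hS.eq]
  have h3 := (hP.conjTranspose_mul_mul_same (1 - S)).trace_nonneg
  rw [h2, Matrix.trace_mul_comm, ← mul_assoc, h1, smul_mul_assoc, Matrix.trace_smul, sub_mul,
    one_mul, Matrix.trace_sub, Matrix.trace_mul_comm S P] at h3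
  have h4 := (Complex.nonneg_iff.mp h3).1
  simp at h4
  linarith

theorem traceNorm_sub_le {P N : Matrix n n ℂ} (hP : P.PosSemidef) (hN : N.PosSemidef) :
    traceNorm (P - N) ≤ P.trace.re + N.trace.re := by
  obtain ⟨S, hS, hS2, hT⟩ := exists_symmetry_trace_eq (hP.isHermitian.sub hN.isHermitian)
  have h1 := trace_mul_symmetry_re_le hP hS hS2
  have h2 := trace_mul_symmetry_re_le hN hS.neg (by rw [neg_mul_neg, hS2])
  have h3 := congrArg Complex.re hT
  rw [sub_mul, Matrix.trace_sub, Complex.sub_re, Complex.ofReal_re] at h3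
  rw [mul_neg, Matrix.trace_neg, Complex.neg_re] at h2
  linarith

end TraceNorm

/-! ### Partial traces, and equality of the two forms of the Wasserstein distance. -/

section PartialTrace

variable {ι : Type*} [Fintype ι] [DecidableEq ι] {κ : ι → Type*} [∀ i, Fintype (κ i)]
  [∀ i, DecidableEq (κ i)]

omit [Fintype ι] [∀ i, DecidableEq (κ i)] in
theorem partialTrace_sub (i : ι) (X Y : Matrix (∀ j, κ j) (∀ j, κ j) ℂ) :
    partialTrace i (X - Y) = partialTrace i X - partialTrace i Y := by
  ext k l
  simp [partialTrace, Finset.sum_sub_distrib]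

omit [Fintype ι] [∀ i, DecidableEq (κ i)] in
theorem partialTrace_smul (i : ι) (c : ℂ) (X : Matrix (∀ j, κ j) (∀ j, κ j) ℂ) :
    partialTrace i (c • X) = c • partialTrace i X := by
  ext k l
  simp [partialTrace, Finset.mul_sum]

omit [∀ i, DecidableEq (κ i)] in
theorem trace_partialTrace (i : ι) (X : Matrix (∀ j, κ j) (∀ j, κ j) ℂ) :
    (partialTrace i X).trace = X.trace := by
  simp only [Matrix.trace, Matrix.diag, partialTrace, Matrix.of_apply]
  rw [← (Equiv.piSplitAt i κ).symm.sum_comp, Fintype.sum_prod_type_right]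

/-- An identity in the `i`-th factor forces equal `i`-th indices, so `X` enters only through its
partial trace. -/
theorem trace_mul_kron_of_eq_one {i : ι} (X : Matrix (∀ j, κ j) (∀ j, κ j) ℂ)
    (a : ∀ j, CStarMatrix (κ j) (κ j) ℂ) (ha : a i = 1) :
    (X * kron a).trace = ∑ k, ∑ l, partialTrace i X k l *
      ∏ j : {j // j ≠ i}, a j (l j) (k j) := by
  have h : ∀ (k l : ∀ j : {j // j ≠ i}, κ j) (m m' : κ i),
      kron a ((Equiv.piSplitAt i κ).symm (m', l)) ((Equiv.piSplitAt i κ).symm (m, k)) =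
        if m' = m then ∏ j : {j // j ≠ i}, a j (l j) (k j) else 0 := by
    intro k l m m'
    rw [kron, Matrix.of_apply, ← Finset.mul_prod_erase _ _ (Finset.mem_univ i)]
    have h1 : ∏ j ∈ Finset.univ.erase i, a j ((Equiv.piSplitAt i κ).symm (m', l) j)
        ((Equiv.piSplitAt i κ).symm (m, k) j) = ∏ j : {j // j ≠ i}, a j (l j) (k j) := by
      refine Eq.trans (b := ∏ j : {j // j ≠ i}, a j ((Equiv.piSplitAt i κ).symm (m', l) j)
        ((Equiv.piSplitAt i κ).symm (m, k) j)) (Finset.prod_subtype _ (by simp) _) ?_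
      refine Finset.prod_congr rfl fun j _ => ?_
      simp [j.2]
    rw [h1, ha, CStarMatrix.one_apply]
    simp
  simp only [Matrix.trace, Matrix.diag, Matrix.mul_apply]
  rw [← (Equiv.piSplitAt i κ).symm.sum_comp, Fintype.sum_prod_type_right]
  refine Finset.sum_congr rfl fun k _ => ?_
  have h2 : ∀ m, ∑ x, X ((Equiv.piSplitAt i κ).symm (m, k)) x *
      kron a x ((Equiv.piSplitAt i κ).symm (m, k)) =
      ∑ l, X ((Equiv.piSplitAt i κ).symm (m, k)) ((Equiv.piSplitAt i κ).symm (m, l)) *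
        ∏ j : {j // j ≠ i}, a j (l j) (k j) := by
    intro m
    rw [← (Equiv.piSplitAt i κ).symm.sum_comp, Fintype.sum_prod_type_right]
    refine Finset.sum_congr rfl fun l _ => ?_
    simp [h]
  simp only [h2]
  rw [Finset.sum_comm]
  refine Finset.sum_congr rfl fun l _ => ?_
  rw [partialTrace, Matrix.of_apply, Finset.sum_mul]

omit [DecidableEq ι] [∀ i, Fintype (κ i)] in
theorem kron_single (k l : ∀ i, κ i) :
    kron (fun i => CStarMatrix.ofMatrix (Matrix.single (k i) (l i) (1 : ℂ))) =
      Matrix.single k l 1 := by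
  ext p q
  simp only [kron, Matrix.of_apply, CStarMatrix.ofMatrix_apply, Matrix.single_apply]
  by_cases h : k = p ∧ l = q
  · obtain ⟨rfl, rfl⟩ := h
    simp
  · rw [if_neg h, Finset.prod_eq_zero_iff]
    by_contra hc
    push Not at hc
    exact h ⟨funext fun i => by_contra fun hi => hc i (Finset.mem_univ i) (by simp [hi]),
      funext fun i => by_contra fun hi => hc i (Finset.mem_univ i) (by simp [hi])⟩

theorem partialTrace_eq_zero_iff (i : ι) (X : Matrix (∀ j, κ j) (∀ j, κ j) ℂ) :
    partialTrace i X = 0 ↔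
      ∀ a : ∀ j, CStarMatrix (κ j) (κ j) ℂ, a i = 1 → (X * kron a).trace = 0 := by
  refine ⟨fun h a ha => by simp [trace_mul_kron_of_eq_one X a ha, h], fun h => ?_⟩
  ext p q
  -- Matrix units away from `i`, with `q` and `p` transposed because the trace pairing transposes;
  -- they isolate the entry `(p, q)` of the partial trace.
  let a : ∀ j, CStarMatrix (κ j) (κ j) ℂ := fun j =>
    if hj : j ≠ i then CStarMatrix.ofMatrix (Matrix.single (q ⟨j, hj⟩) (p ⟨j, hj⟩) 1) else 1
  have ha : a i = 1 := by simp [a]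
  have h1 := h a ha
  rw [trace_mul_kron_of_eq_one X a ha] at h1
  have h2 : ∀ k l : (∀ j : {j // j ≠ i}, κ j), ∏ j : {j // j ≠ i}, a j (l j) (k j) =
      if p = k ∧ q = l then 1 else 0 := by
    intro k l
    have h3 := congrFun (congrFun (kron_single (κ := fun j : {j // j ≠ i} => κ j) q p) l) k
    rw [kron, Matrix.of_apply, Matrix.single_apply] at h3
    simp only [and_comm (a := p = k)]
    rw [← h3]
    refine Finset.prod_congr rfl fun j _ => ?_
    have h4 : a j = CStarMatrix.ofMatrix (Matrix.single (q j) (p j) 1) := dif_pos j.2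
    rw [h4]
  simp only [h2] at h1
  rw [Fintype.sum_eq_single p, Fintype.sum_eq_single q] at h1
  · simpa using h1
  · intro l hl
    simp [hl.symm]
  · intro k hk
    simp [hk.symm]

theorem wassersteinOne_le_wassersteinOneNeighbor (ρ σ : Matrix (∀ i, κ i) (∀ i, κ i) ℂ) :
    wassersteinOne ρ σ ≤ wassersteinOneNeighbor ρ σ := by
  refine le_iInf fun c => le_iInf fun R => le_iInf fun S => le_iInf fun h => ?_
  obtain ⟨h1, h2⟩ := h
  refine iInf₂_le_of_le (fun i => ((c i : ℝ) : ℂ) • (R i - S i)) ⟨fun i => ⟨?_, ?_⟩, h2⟩ ?_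
  · have h3 := (h1 i).1.1.isHermitian.sub (h1 i).2.1.1.isHermitian
    rw [Matrix.IsHermitian, Matrix.conjTranspose_smul, h3.eq]
    simp
  · rw [partialTrace_smul, partialTrace_sub, (h1 i).2.2, sub_self, smul_zero]
  · have h3 : ∀ i, traceNorm (((c i : ℝ) : ℂ) • (R i - S i)) ≤ 2 * c i := by
      intro i
      have hc : (0 : ℂ) ≤ ((c i : ℝ) : ℂ) := Complex.zero_le_real.mpr (c i).2
      rw [smul_sub]
      refine (traceNorm_sub_le ((h1 i).1.1.smul hc) ((h1 i).2.1.1.smul hc)).trans_eq ?_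
      rw [Matrix.trace_smul, Matrix.trace_smul, (h1 i).1.2, (h1 i).2.1.2]
      simp
      ring
    calc _ ≤ ENNReal.ofReal (∑ i, (c i : ℝ)) := by
          refine ENNReal.ofReal_le_ofReal ?_
          have := Finset.sum_le_sum fun i (_ : i ∈ Finset.univ) => h3 i
          rw [← Finset.mul_sum] at this
          linarith
      _ = ∑ i, (c i : ℝ≥0∞) := by
          rw [ENNReal.ofReal_sum_of_nonneg fun i _ => NNReal.coe_nonneg (c i)]
          simp

/-- `Trᵢ X = 0` gives `Tr X = 0`, so the Jordan parts share the trace `½ ‖X‖₁` and can be normalized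
by it. -/
theorem exists_neighbors {i : ι} {X : Matrix (∀ i, κ i) (∀ i, κ i) ℂ} (hX : X.IsHermitian)
    (hX0 : partialTrace i X = 0) {ρ : Matrix (∀ i, κ i) (∀ i, κ i) ℂ} (hρ : IsDensityMatrix ρ) :
    ∃ R S : Matrix (∀ i, κ i) (∀ i, κ i) ℂ, IsDensityMatrix R ∧ IsDensityMatrix S ∧
      partialTrace i R = partialTrace i S ∧ X = ((1 / 2 * traceNorm X : ℝ) : ℂ) • (R - S) := by
  obtain ⟨P, N, hP, hN, hPN, hT⟩ := exists_posSemidef_sub_eq hX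
  have htr : P.trace = N.trace := by
    rw [← sub_eq_zero, ← Matrix.trace_sub, ← hPN, ← trace_partialTrace i, hX0, Matrix.trace_zero]
  have hP1 : P.trace = ((1 / 2 * traceNorm X : ℝ) : ℂ) := by
    push_cast
    rw [hT, ← htr]
    ring
  set c : ℝ := 1 / 2 * traceNorm X with hc
  rcases eq_or_ne c 0 with h0 | h0
  -- Here `X = 0` and nothing can be normalized; `ρ` is just some density matrix to fill both
  -- places.
  · refine ⟨ρ, ρ, hρ, hρ, rfl, ?_⟩
    rw [h0, Complex.ofReal_zero] at hP1
    rw [sub_self, smul_zero, hPN, hP.trace_eq_zero_iff.mp hP1,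
      hN.trace_eq_zero_iff.mp (htr ▸ hP1), sub_zero]
  · have hc0 : (c : ℂ) ≠ 0 := Complex.ofReal_ne_zero.mpr h0
    have hcpos : (0 : ℂ) ≤ ((c⁻¹ : ℝ) : ℂ) :=
      Complex.zero_le_real.mpr (inv_nonneg.mpr (by have := traceNorm_nonneg X; positivity))
    refine ⟨((c⁻¹ : ℝ) : ℂ) • P, ((c⁻¹ : ℝ) : ℂ) • N, ⟨hP.smul hcpos, ?_⟩, ⟨hN.smul hcpos, ?_⟩,
      ?_, ?_⟩
    · rw [Matrix.trace_smul, hP1, smul_eq_mul, Complex.ofReal_inv, inv_mul_cancel₀ hc0]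
    · rw [Matrix.trace_smul, ← htr, hP1, smul_eq_mul, Complex.ofReal_inv, inv_mul_cancel₀ hc0]
    · rw [partialTrace_smul, partialTrace_smul]
      congr 1
      rw [← sub_eq_zero, ← partialTrace_sub, ← hPN, hX0]
    · rw [← smul_sub, ← hPN, smul_smul, Complex.ofReal_inv, mul_inv_cancel₀ hc0, one_smul]

theorem wassersteinOneNeighbor_le_wassersteinOne {ρ σ : Matrix (∀ i, κ i) (∀ i, κ i) ℂ}
    (hρ : IsDensityMatrix ρ) : wassersteinOneNeighbor ρ σ ≤ wassersteinOne ρ σ := by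
  refine le_iInf₂ fun X hX => ?_
  choose R S hR hS hRS hXRS using fun i => exists_neighbors (hX.1 i).1 (hX.1 i).2 hρ
  have hnn : ∀ i, 0 ≤ 1 / 2 * traceNorm (X i) := fun i => by
    have := traceNorm_nonneg (X i)
    positivity
  refine iInf_le_of_le (fun i => ⟨1 / 2 * traceNorm (X i), hnn i⟩) (iInf_le_of_le R
    (iInf_le_of_le S (iInf_le_of_le ⟨fun i => ⟨hR i, hS i, hRS i⟩, ?_⟩ (le_of_eq ?_))))
  · rw [hX.2]
    exact Finset.sum_congr rfl fun i _ => hXRS i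
  · rw [Finset.mul_sum, ENNReal.ofReal_sum_of_nonneg fun i _ => hnn i]
    refine Finset.sum_congr rfl fun i _ => ?_
    rw [ENNReal.ofReal_eq_coe_nnreal (hnn i)]
    rfl

theorem wassersteinOne_eq_wassersteinOneNeighbor {ρ σ : Matrix (∀ i, κ i) (∀ i, κ i) ℂ}
    (hρ : IsDensityMatrix ρ) : wassersteinOne ρ σ = wassersteinOneNeighbor ρ σ :=
  le_antisymm (wassersteinOne_le_wassersteinOneNeighbor ρ σ)
    (wassersteinOneNeighbor_le_wassersteinOne hρ)

end PartialTrace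

/-! ### The tensor product of matrix algebras as one matrix algebra. -/

section MatrixTensor

variable {ι : Type*} [Fintype ι] [DecidableEq ι] {κ : ι → Type*} [∀ i, Fintype (κ i)]
  [∀ i, DecidableEq (κ i)] {H : ι → Type*} [∀ i, NormedAddCommGroup (H i)]
  [∀ i, InnerProductSpace ℂ (H i)] [∀ i, CompleteSpace (H i)]
  (π : ∀ i, CStarMatrix (κ i) (κ i) ℂ →⋆ₐ[ℂ] (H i →L[ℂ] H i))

omit [DecidableEq ι] in
theorem elemTensor_eq_zero {A : ι → Type*} [∀ i, CStarAlgebra (A i)]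
    (π : ∀ i, A i →⋆ₐ[ℂ] (H i →L[ℂ] H i)) {a : ∀ i, A i} (i : ι) (ha : a i = 0) :
    elemTensor π a = 0 := by
  rw [← ofTensor_tprod, (PiTensorProduct.tprod ℂ).map_coord_zero i ha, map_zero]

/-- The matrix units of `⊗ᵢ M_{κᵢ}(ℂ)`. -/
def unitTensor (k l : ∀ i, κ i) : minTensor π :=
  elemTensor π fun i => CStarMatrix.ofMatrix (Matrix.single (k i) (l i) 1)

omit [Fintype ι] [DecidableEq ι] in
theorem single_mul_single (i : ι) (k l l' m : κ i) :
    (CStarMatrix.ofMatrix (Matrix.single k l 1) * CStarMatrix.ofMatrix (Matrix.single l' m 1) :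
      CStarMatrix (κ i) (κ i) ℂ) =
      if l = l' then CStarMatrix.ofMatrix (Matrix.single k m 1) else 0 := by
  split_ifs with h
  · subst h
    change CStarMatrix.ofMatrix (Matrix.single k l (1 : ℂ) * Matrix.single l m 1) = _
    rw [Matrix.single_mul_single_same, one_mul]
  · change CStarMatrix.ofMatrix (Matrix.single k l (1 : ℂ) * Matrix.single l' m 1) = _
    rw [Matrix.single_mul_single_of_ne _ _ _ _ h]
    rfl

omit [DecidableEq ι] in
theorem unitTensor_mul (k l l' m : ∀ i, κ i) :
    unitTensor π k l * unitTensor π l' m = if l = l' then unitTensor π k m else 0 := by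
  rw [unitTensor, unitTensor, ← elemTensor_mul]
  simp only [single_mul_single]
  split_ifs with h
  · subst h
    simp [unitTensor]
  · obtain ⟨i, hi⟩ := Function.ne_iff.mp h
    exact elemTensor_eq_zero π i (if_neg hi)

omit [DecidableEq ι] in
theorem unitTensor_star (k l : ∀ i, κ i) : star (unitTensor π k l) = unitTensor π l k := by
  rw [unitTensor, unitTensor, ← elemTensor_star]
  congr 1
  funext i
  change CStarMatrix.ofMatrix (Matrix.conjTranspose (Matrix.single (k i) (l i) (1 : ℂ))) = _
  rw [Matrix.conjTranspose_single, star_one]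

/-- The linear map from the matrices indexed by `∏ᵢ κᵢ` to `⊗ᵢ M_{κᵢ}(ℂ)`. -/
def ofMatrixLin : Matrix (∀ i, κ i) (∀ i, κ i) ℂ →ₗ[ℂ] minTensor π where
  toFun M := ∑ k, ∑ l, M k l • unitTensor π k l
  map_add' M N := by simp only [Matrix.add_apply, add_smul, Finset.sum_add_distrib]
  map_smul' c M := by
    simp only [Matrix.smul_apply, smul_eq_mul, mul_smul, Finset.smul_sum, RingHom.id_apply]

theorem ofMatrixLin_apply (M : Matrix (∀ i, κ i) (∀ i, κ i) ℂ) :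
    ofMatrixLin π M = ∑ k, ∑ l, M k l • unitTensor π k l := rfl

theorem ofMatrixLin_single (k l : ∀ i, κ i) :
    ofMatrixLin π (Matrix.single k l 1) = unitTensor π k l := by
  rw [ofMatrixLin_apply, Fintype.sum_eq_single k, Fintype.sum_eq_single l]
  · simp
  · intro l' hl
    simp [hl.symm]
  · intro k' hk
    simp [hk.symm]

/-- Expand every `a i` in matrix units and use multilinearity; the resulting sum over families of
pairs is reindexed as a sum over pairs of families. -/
theorem ofMatrixLin_kron (a : ∀ i, CStarMatrix (κ i) (κ i) ℂ) :
    ofMatrixLin π (kron a) = elemTensor π a := by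
  have ha : a = fun i => ∑ p : κ i × κ i,
      a i p.1 p.2 • CStarMatrix.ofMatrix (Matrix.single p.1 p.2 (1 : ℂ)) := by
    funext i
    have h := Matrix.matrix_eq_sum_single (CStarMatrix.ofMatrix.symm (a i))
    rw [Fintype.sum_prod_type]
    conv_lhs => rw [← Equiv.apply_symm_apply CStarMatrix.ofMatrix (a i), h]
    change (∑ p, ∑ q, Matrix.single p q (a i p q) : Matrix (κ i) (κ i) ℂ) =
      (∑ p, ∑ q, a i p q • Matrix.single p q (1 : ℂ) : Matrix (κ i) (κ i) ℂ)
    simp only [Matrix.smul_single, smul_eq_mul, mul_one]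
  let e : (∀ i, κ i × κ i) ≃ (∀ i, κ i) × (∀ i, κ i) :=
    { toFun r := (fun i => (r i).1, fun i => (r i).2)
      invFun s i := (s.1 i, s.2 i) }
  rw [ofMatrixLin_apply, ← ofTensor_tprod]
  conv_rhs => rw [ha]
  rw [MultilinearMap.map_sum, map_sum, ← Fintype.sum_prod_type' (f := fun k l => kron a k l • unitTensor π k l), ← e.sum_comp]
  refine Finset.sum_congr rfl fun r _ => ?_
  rw [(PiTensorProduct.tprod ℂ).map_smul_univ, map_smul, ofTensor_tprod]
  rfl

theorem ofMatrixLin_one : ofMatrixLin π 1 = 1 := by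
  have h : (1 : Matrix (∀ i, κ i) (∀ i, κ i) ℂ) =
      kron fun i => (1 : CStarMatrix (κ i) (κ i) ℂ) := by
    ext k l
    simp only [kron, Matrix.of_apply, Matrix.one_apply, CStarMatrix.one_apply]
    split_ifs with hkl
    · subst hkl
      simp
    · obtain ⟨i, hi⟩ := Function.ne_iff.mp hkl
      exact (Finset.prod_eq_zero (Finset.mem_univ i) (if_neg hi)).symm
  rw [h, ofMatrixLin_kron, elemTensor_one]

theorem ofMatrixLin_mul (M N : Matrix (∀ i, κ i) (∀ i, κ i) ℂ) :
    ofMatrixLin π (M * N) = ofMatrixLin π M * ofMatrixLin π N := by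
  have h : ∀ k, (∑ m, M k m • unitTensor π k m) * ofMatrixLin π N =
      ∑ l, (M * N) k l • unitTensor π k l := by
    intro k
    have h1 : ∀ m, unitTensor π k m * ofMatrixLin π N = ∑ l, N m l • unitTensor π k l := by
      intro m
      rw [ofMatrixLin_apply, Finset.mul_sum, Fintype.sum_eq_single m]
      · simp only [Finset.mul_sum, mul_smul_comm, unitTensor_mul, if_true]
      · intro m' hm
        simp only [Finset.mul_sum, mul_smul_comm, unitTensor_mul, if_neg hm.symm, smul_zero,
          Finset.sum_const_zero]
    simp only [Finset.sum_mul, smul_mul_assoc, h1, Finset.smul_sum, smul_smul, Matrix.mul_apply,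
      Finset.sum_smul]
    rw [Finset.sum_comm]
  rw [ofMatrixLin_apply π M, Finset.sum_mul, ofMatrixLin_apply]
  exact Finset.sum_congr rfl fun k _ => (h k).symm

theorem ofMatrixLin_star (M : Matrix (∀ i, κ i) (∀ i, κ i) ℂ) :
    ofMatrixLin π M.conjTranspose = star (ofMatrixLin π M) := by
  simp only [ofMatrixLin_apply, star_sum, star_smul, unitTensor_star, Matrix.conjTranspose_apply]
  rw [Finset.sum_comm]

/-- Simplicity of the matrix algebra: sandwiching `M` between matrix units and summing over `p`
shows that a kernel element has `M k l • 1 = 0` for every entry. -/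
theorem ofMatrixLin_injective [Nontrivial (minTensor π)] :
    Function.Injective (ofMatrixLin π) := by
  rw [← LinearMap.ker_eq_bot, LinearMap.ker_eq_bot']
  intro M hM
  ext k l
  have h1 : ∀ p, M k l • unitTensor π p p = 0 := by
    intro p
    have h2 : M k l • Matrix.single p p (1 : ℂ) = Matrix.single p k 1 * M * Matrix.single l p 1 := by
      rw [Matrix.single_mul_mul_single, Matrix.smul_single]
      simp
    rw [← ofMatrixLin_single, ← map_smul, h2, ofMatrixLin_mul, ofMatrixLin_mul, hM, mul_zero,
      zero_mul]
  have h2 : M k l • (1 : minTensor π) = 0 := by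
    rw [← ofMatrixLin_one, ofMatrixLin_apply, Finset.smul_sum]
    refine Finset.sum_eq_zero fun p _ => ?_
    rw [Fintype.sum_eq_single p fun q hq => by rw [Matrix.one_apply_ne hq.symm, zero_smul],
      Matrix.one_apply_eq, one_smul, h1]
  exact (smul_eq_zero.mp h2).resolve_right one_ne_zero

/-- The range is closed because it is finite-dimensional, and it contains the dense algebraic tensor
product. -/
theorem ofMatrixLin_surjective : Function.Surjective (ofMatrixLin π) := by
  have hcl : IsClosed (LinearMap.range (ofMatrixLin π) : Set (minTensor π)) :=
    Submodule.closed_of_finiteDimensional _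
  have hle : LinearMap.range (ofTensor π) ≤ LinearMap.range (ofMatrixLin π) := by
    rintro _ ⟨t, rfl⟩
    induction t using PiTensorProduct.induction_on with
    | smul_tprod r a =>
      rw [map_smul, ofTensor_tprod, ← ofMatrixLin_kron]
      exact Submodule.smul_mem _ _ ⟨_, rfl⟩
    | add x y hx hy =>
      rw [map_add]
      exact add_mem hx hy
  intro x
  exact closure_minimal (SetLike.coe_subset_coe.mpr hle) hcl (denseRange_ofTensor π x)

theorem exists_functional [Nontrivial (minTensor π)] (X : Matrix (∀ i, κ i) (∀ i, κ i) ℂ) :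
    ∃ φ : minTensor π →L[ℂ] ℂ, ∀ M, φ (ofMatrixLin π M) = (X * M).trace := by
  let e := LinearEquiv.ofBijective (ofMatrixLin π)
    ⟨ofMatrixLin_injective π, ofMatrixLin_surjective π⟩
  have : FiniteDimensional ℂ (minTensor π) := e.finiteDimensional
  refine ⟨LinearMap.toContinuousLinearMap
    (Matrix.traceLinearMap (∀ i, κ i) ℂ ℂ ∘ₗ LinearMap.mulLeft ℂ X ∘ₗ e.symm.toLinearMap), ?_⟩
  intro M
  change (X * e.symm (e M)).trace = _
  rw [e.symm_apply_apply]

theorem exists_matrix (φ : minTensor π →L[ℂ] ℂ) :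
    ∃ X : Matrix (∀ i, κ i) (∀ i, κ i) ℂ, ∀ M, φ (ofMatrixLin π M) = (X * M).trace := by
  refine ⟨Matrix.of fun k l => φ (unitTensor π l k), fun M => ?_⟩
  simp only [ofMatrixLin_apply, map_sum, map_smul, smul_eq_mul, Matrix.trace, Matrix.diag,
    Matrix.mul_apply, Matrix.of_apply]
  rw [Finset.sum_comm]
  exact Finset.sum_congr rfl fun k _ => Finset.sum_congr rfl fun l _ => mul_comm _ _

theorem isGivenBy_iff (φ : minTensor π →L[ℂ] ℂ) (X : Matrix (∀ i, κ i) (∀ i, κ i) ℂ) :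
    IsGivenBy π φ X ↔ ∀ M, φ (ofMatrixLin π M) = (X * M).trace := by
  refine ⟨fun h M => ?_, fun h a => by rw [← ofMatrixLin_kron, h]⟩
  obtain ⟨Y, hY⟩ := exists_matrix π φ
  have hXY : Y = X := by
    ext k l
    have h1 := hY (Matrix.single l k 1)
    rw [← kron_single, ofMatrixLin_kron, h, kron_single, Matrix.trace_mul_single,
      Matrix.trace_mul_single] at h1
    simpa using h1.symm
  rw [hY, hXY]

end MatrixTensor

/-! ### Dictionary between functionals and matrices, and the Wasserstein formula. -/

section MatrixTensor

variable {ι : Type*} [Fintype ι] [DecidableEq ι] {κ : ι → Type*} [∀ i, Fintype (κ i)]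
  [∀ i, DecidableEq (κ i)] {H : ι → Type*} [∀ i, NormedAddCommGroup (H i)]
  [∀ i, InnerProductSpace ℂ (H i)] [∀ i, CompleteSpace (H i)]
  {π : ∀ i, CStarMatrix (κ i) (κ i) ℂ →⋆ₐ[ℂ] (H i →L[ℂ] H i)}

theorem star_mul_self_ofMatrixLin (M : Matrix (∀ i, κ i) (∀ i, κ i) ℂ) :
    star (ofMatrixLin π M) * ofMatrixLin π M = ofMatrixLin π (M.conjTranspose * M) := by
  rw [ofMatrixLin_mul, ofMatrixLin_star]

theorem apply_one_of_isGivenBy {φ : minTensor π →L[ℂ] ℂ} {X : Matrix (∀ i, κ i) (∀ i, κ i) ℂ}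
    (h : IsGivenBy π φ X) : φ 1 = X.trace := by
  rw [← ofMatrixLin_one, (isGivenBy_iff π φ X).mp h, mul_one]

theorem isSelfAdjointFunctional_iff_isHermitian {φ : minTensor π →L[ℂ] ℂ}
    {X : Matrix (∀ i, κ i) (∀ i, κ i) ℂ} (h : IsGivenBy π φ X) :
    IsSelfAdjointFunctional φ ↔ X.IsHermitian := by
  rw [isGivenBy_iff] at h
  have h1 : ∀ M, starRingEnd ℂ (φ (star (ofMatrixLin π M))) = (X.conjTranspose * M).trace := by
    intro M
    rw [← ofMatrixLin_star, h, starRingEnd_apply, ← Matrix.trace_conjTranspose,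
      Matrix.conjTranspose_mul, Matrix.conjTranspose_conjTranspose, Matrix.trace_mul_comm]
  refine ⟨fun hs => ?_, fun hX b => ?_⟩
  · rw [Matrix.IsHermitian, Matrix.ext_iff_trace_mul_right]
    intro M
    rw [← h1, hs, h]
  · obtain ⟨M, rfl⟩ := ofMatrixLin_surjective π b
    rw [h1, h, hX.eq]

open scoped MatrixOrder in
theorem positive_iff_posSemidef {φ : minTensor π →L[ℂ] ℂ}
    {X : Matrix (∀ i, κ i) (∀ i, κ i) ℂ} (h : IsGivenBy π φ X) :
    (∀ b, 0 ≤ φ (star b * b)) ↔ X.PosSemidef := by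
  have h' := (isGivenBy_iff π φ X).mp h
  refine ⟨fun hp => ?_, fun hX b => ?_⟩
  · refine Matrix.PosSemidef.of_dotProduct_mulVec_nonneg
      ((isSelfAdjointFunctional_iff_isHermitian h).mp (minTensor_positive_selfAdjoint π hp)) ?_
    intro x
    -- The rank one matrix of `x` has the form `Bᴴ B`, so positivity of `φ` at `B` is the quadratic
    -- form of `X` at `x`.
    obtain ⟨B, hB⟩ := CStarAlgebra.nonneg_iff_eq_star_mul_self.mp
      (Matrix.posSemidef_vecMulVec_self_star x).nonneg
    have h1 := hp (ofMatrixLin π B)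
    rw [star_mul_self_ofMatrixLin, h', ← Matrix.star_eq_conjTranspose, ← hB, Matrix.mul_vecMulVec, Matrix.trace_vecMulVec,
      dotProduct_comm] at h1
    exact h1
  · obtain ⟨M, rfl⟩ := ofMatrixLin_surjective π b
    rw [star_mul_self_ofMatrixLin, h', ← mul_assoc, Matrix.trace_mul_comm, ← mul_assoc]
    exact (hX.mul_mul_conjTranspose_same M).trace_nonneg

theorem isState_iff_isDensityMatrix {φ : minTensor π →L[ℂ] ℂ}
    {X : Matrix (∀ i, κ i) (∀ i, κ i) ℂ} (h : IsGivenBy π φ X) :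
    IsState φ ↔ IsDensityMatrix X := by
  rw [isState_minTensor_iff, positive_iff_posSemidef h, apply_one_of_isGivenBy h, IsDensityMatrix]

theorem vanishes_iff_partialTrace_eq_zero {φ : minTensor π →L[ℂ] ℂ}
    {X : Matrix (∀ i, κ i) (∀ i, κ i) ℂ} (h : IsGivenBy π φ X) (i : ι) :
    (∀ c ∈ tilde π i, φ c = 0) ↔ partialTrace i X = 0 := by
  rw [eq_zero_on_tilde_iff, partialTrace_eq_zero_iff]
  exact forall₂_congr fun a _ => by rw [h a]

theorem existsUnique_matrix (φ : minTensor π →L[ℂ] ℂ) : ∃! X, IsGivenBy π φ X := by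
  obtain ⟨X, hX⟩ := exists_matrix π φ
  refine ⟨X, (isGivenBy_iff π φ X).mpr hX, fun Y hY => ?_⟩
  rw [Matrix.ext_iff_trace_mul_right]
  intro M
  rw [← hX, (isGivenBy_iff π φ Y).mp hY]

theorem existsUnique_functional [Nontrivial (minTensor π)]
    (X : Matrix (∀ i, κ i) (∀ i, κ i) ℂ) : ∃! φ : minTensor π →L[ℂ] ℂ, IsGivenBy π φ X := by
  obtain ⟨φ, hφ⟩ := exists_functional π X
  refine ⟨φ, (isGivenBy_iff π φ X).mpr hφ, fun ψ hψ => ContinuousLinearMap.ext fun b => ?_⟩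
  obtain ⟨M, rfl⟩ := ofMatrixLin_surjective π b
  rw [hφ, (isGivenBy_iff π ψ X).mp hψ]

theorem isGivenBy_sub_iff_sum {μ ν : minTensor π →L[ℂ] ℂ} {ρ σ : Matrix (∀ i, κ i) (∀ i, κ i) ℂ}
    (hμ : IsGivenBy π μ ρ) (hν : IsGivenBy π ν σ) {φ : ι → minTensor π →L[ℂ] ℂ}
    {X : ι → Matrix (∀ i, κ i) (∀ i, κ i) ℂ} (h : ∀ i, IsGivenBy π (φ i) (X i)) :
    μ - ν = ∑ i, φ i ↔ ρ - σ = ∑ i, X i := by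
  rw [isGivenBy_iff] at hμ hν
  have h' := fun i => (isGivenBy_iff π (φ i) (X i)).mp (h i)
  have h1 : ∀ M, (μ - ν) (ofMatrixLin π M) = ((ρ - σ) * M).trace := by
    intro M
    rw [sub_mul, Matrix.trace_sub, ← hμ, ← hν]
    rfl
  have h2 : ∀ M, (∑ i, φ i) (ofMatrixLin π M) = ((∑ i, X i) * M).trace := by
    intro M
    rw [Finset.sum_mul, Matrix.trace_sum, sum_apply]
    exact Finset.sum_congr rfl fun i _ => h' i M
  refine ⟨fun hs => ?_, fun hs => ContinuousLinearMap.ext fun b => ?_⟩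
  · rw [Matrix.ext_iff_trace_mul_right]
    intro M
    rw [← h1, ← h2, hs]
  · obtain ⟨M, rfl⟩ := ofMatrixLin_surjective π b
    rw [h1, h2, hs]

/-- The Jordan parts of `X` define positive functionals, whose bounds are their values at `1`,
namely the traces of `P` and `N`. -/
theorem norm_apply_le_traceNorm [Nontrivial (minTensor π)] {φ : minTensor π →L[ℂ] ℂ}
    {X : Matrix (∀ i, κ i) (∀ i, κ i) ℂ} (h : IsGivenBy π φ X) (hX : X.IsHermitian)
    (a : minTensor π) : ‖φ a‖ ≤ traceNorm X * ‖a‖ := by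
  obtain ⟨P, N, hP, hN, hPN, hT⟩ := exists_posSemidef_sub_eq hX
  obtain ⟨p, hp, -⟩ := existsUnique_functional (π := π) P
  obtain ⟨q, hq, -⟩ := existsUnique_functional (π := π) N
  have h1 := minTensor_positive_norm_le π ((positive_iff_posSemidef hp).mpr hP) a
  have h2 := minTensor_positive_norm_le π ((positive_iff_posSemidef hq).mpr hN) a
  rw [apply_one_of_isGivenBy hp] at h1
  rw [apply_one_of_isGivenBy hq] at h2
  have h3 : φ a = p a - q a := by
    obtain ⟨M, rfl⟩ := ofMatrixLin_surjective π a
    rw [(isGivenBy_iff π φ X).mp h, (isGivenBy_iff π p P).mp hp, (isGivenBy_iff π q N).mp hq, hPN,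
      sub_mul, Matrix.trace_sub]
  have h4 : traceNorm X = P.trace.re + N.trace.re := by
    rw [← Complex.add_re, ← hT, Complex.ofReal_re]
  rw [h3, h4, add_mul]
  exact (norm_sub_le _ _).trans (add_le_add h1 h2)

theorem norm_ofMatrixLin_symmetry_le {S : Matrix (∀ i, κ i) (∀ i, κ i) ℂ} (hS : S.IsHermitian)
    (hS2 : S * S = 1) : ‖ofMatrixLin π S‖ ≤ 1 := by
  have h1 : star (ofMatrixLin π S) * ofMatrixLin π S = 1 := by
    rw [star_mul_self_ofMatrixLin, hS.eq, hS2, ofMatrixLin_one]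
  set s : HilbertTensor H →L[ℂ] HilbertTensor H := (ofMatrixLin π S).val
  have h2 : star s * s = 1 := congrArg Subtype.val h1
  have h3 := CStarRing.norm_star_mul_self (x := s)
  rw [h2] at h3
  have h4 : ‖(1 : HilbertTensor H →L[ℂ] HilbertTensor H)‖ ≤ 1 := ContinuousLinearMap.norm_id_le
  change ‖s‖ ≤ 1
  nlinarith [norm_nonneg s]

/-- For the upper bound, subtract from `a` an element of `Ãᵢ` at distance close to `1 / 2`, which
`φ` does not see. The lower bound is attained at half the sign of `X`. -/
theorem dualNorm_eq_traceNorm [Nontrivial (minTensor π)] {φ : minTensor π →L[ℂ] ℂ}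
    {X : Matrix (∀ i, κ i) (∀ i, κ i) ℂ} (h : IsGivenBy π φ X) (hX : X.IsHermitian) {i : ι}
    (h0 : ∀ c ∈ tilde π i, φ c = 0) :
    dualNorm π i φ = ENNReal.ofReal (1 / 2 * traceNorm X) := by
  refine le_antisymm (iSup₂_le fun a ha => ENNReal.ofReal_le_ofReal ?_) ?_
  · have key : ∀ r, 1 / 2 < r → ‖φ a‖ ≤ r * traceNorm X := by
      intro r hr
      obtain ⟨c, hc, hac⟩ := exists_mem_tilde_of_partialL_lt π (i := i) (a := a) (r := r)
        (by linarith)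
      have h1 := norm_apply_le_traceNorm h hX (a - c)
      rw [map_sub, h0 c hc, sub_zero] at h1
      refine h1.trans ?_
      rw [mul_comm]
      exact mul_le_mul_of_nonneg_right hac.le (traceNorm_nonneg X)
    have hlim : Filter.Tendsto (fun r : ℝ => r * traceNorm X)
        (nhdsWithin (1 / 2) (Set.Ioi (1 / 2))) (nhds (1 / 2 * traceNorm X)) :=
      ((continuous_id.mul continuous_const).tendsto (1 / 2)).mono_left nhdsWithin_le_nhds
    exact ge_of_tendsto hlim (Filter.eventually_of_mem self_mem_nhdsWithin key)
  · obtain ⟨S, hS, hS2, hT⟩ := exists_symmetry_trace_eq hX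
    have hhalf : ‖(1 / 2 : ℂ)‖ = 1 / 2 := by norm_num
    -- Comparison with `0 ∈ Ãᵢ` already gives `Lᵢ ≤ 1`, since `S` is sent to an element of norm at
    -- most `1`.
    refine le_iSup₂_of_le (ofMatrixLin π ((1 / 2 : ℂ) • S)) ?_ (ENNReal.ofReal_le_ofReal ?_)
    · refine (partialL_le π i _ (zero_mem _)).trans ?_
      rw [sub_zero, map_smul, norm_smul, hhalf]
      linarith [norm_ofMatrixLin_symmetry_le (π := π) hS hS2]
    · rw [map_smul, map_smul, (isGivenBy_iff π φ X).mp h, hT, norm_smul, hhalf, Complex.norm_real,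
        Real.norm_of_nonneg (traceNorm_nonneg X)]

omit [DecidableEq ι] in
theorem nontrivial_of_isState {A : ι → Type*} [∀ i, CStarAlgebra (A i)]
    {π : ∀ i, A i →⋆ₐ[ℂ] (H i →L[ℂ] H i)} {μ : minTensor π →L[ℂ] ℂ} (hμ : IsState μ) :
    Nontrivial (minTensor π) := by
  refine ⟨1, 0, fun h => zero_ne_one (α := ℂ) ?_⟩
  rw [← ((isState_minTensor_iff π).mp hμ).2, h, map_zero]

/-- Trace one excludes an empty index set, hence every matrix factor is nonzero, and faithfulness of
`π i` makes every `H i` nonzero. -/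
theorem nontrivial_of_isDensityMatrix (hπ : ∀ i, Function.Injective (π i))
    {ρ : Matrix (∀ i, κ i) (∀ i, κ i) ℂ} (hρ : IsDensityMatrix ρ) : Nontrivial (minTensor π) := by
  have hne : Nonempty (∀ i, κ i) := by
    by_contra h
    rw [not_nonempty_iff] at h
    have h1 := hρ.2
    rw [Matrix.trace, Finset.univ_eq_empty, Finset.sum_empty] at h1
    exact zero_ne_one h1
  obtain ⟨k⟩ := hne
  have hH : ∀ i, Nontrivial (H i) := by
    intro i
    by_contra h
    rw [not_nontrivial_iff_subsingleton] at h
    have h1 : (1 : CStarMatrix (κ i) (κ i) ℂ) = 0 :=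
      hπ i (ContinuousLinearMap.ext fun x => Subsingleton.elim _ _)
    have h2 := congrFun (congrFun h1 (k i)) (k i)
    rw [CStarMatrix.one_apply, if_pos rfl] at h2
    exact one_ne_zero h2
  have := nontrivial_hilbertTensor (H := H)
  refine ⟨1, 0, fun h => ?_⟩
  exact one_ne_zero (α := HilbertTensor H →L[ℂ] HilbertTensor H) (congrArg Subtype.val h)

/-- The dictionary matches admissible families of functionals with admissible families of matrices,
and `key` matches their costs. -/
theorem hammingDist_eq_wassersteinOne {μ ν : minTensor π →L[ℂ] ℂ}
    {ρ σ : Matrix (∀ i, κ i) (∀ i, κ i) ℂ} (hμ : IsState μ) (hν : IsState ν)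
    (hμρ : IsGivenBy π μ ρ) (hνσ : IsGivenBy π ν σ) :
    hammingDist π μ ν = wassersteinOne ρ σ := by
  have := nontrivial_of_isState hμ
  rw [hammingDist_eq_iInf π hμ hν]
  have key : ∀ (φ : ι → minTensor π →L[ℂ] ℂ) (X : ι → Matrix (∀ i, κ i) (∀ i, κ i) ℂ),
      (∀ i, IsGivenBy π (φ i) (X i)) → (∀ i, (X i).IsHermitian) →
      (∀ i, ∀ c ∈ tilde π i, φ i c = 0) →
      ∑ i, dualNorm π i (φ i) = ENNReal.ofReal (1 / 2 * ∑ i, traceNorm (X i)) := by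
    intro φ X h hX h0
    rw [Finset.mul_sum, ENNReal.ofReal_sum_of_nonneg fun i _ => by
      have := traceNorm_nonneg (X i)
      positivity]
    exact Finset.sum_congr rfl fun i _ => dualNorm_eq_traceNorm (h i) (hX i) (h0 i)
  refine le_antisymm (le_iInf₂ fun X hX => ?_) (le_iInf₂ fun φ hφ => ?_)
  · choose φ hφ _ using fun i => existsUnique_functional (π := π) (X i)
    have h0 : ∀ i, ∀ c ∈ tilde π i, φ i c = 0 := fun i =>
      (vanishes_iff_partialTrace_eq_zero (hφ i) i).mpr (hX.1 i).2
    rw [← key φ X hφ (fun i => (hX.1 i).1) h0]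
    exact iInf₂_le φ ⟨fun i => ⟨h0 i,
      (isSelfAdjointFunctional_iff_isHermitian (hφ i)).mpr (hX.1 i).1⟩,
      (isGivenBy_sub_iff_sum hμρ hνσ hφ).mpr hX.2⟩
  · choose X hX _ using fun i => existsUnique_matrix (φ i)
    have hH : ∀ i, (X i).IsHermitian := fun i =>
      (isSelfAdjointFunctional_iff_isHermitian (hX i)).mp (hφ.1 i).2
    rw [key φ X hX hH fun i => (hφ.1 i).1]
    exact iInf₂_le X ⟨fun i => ⟨hH i,
      (vanishes_iff_partialTrace_eq_zero (hX i) i).mp (hφ.1 i).1⟩,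
      (isGivenBy_sub_iff_sum hμρ hνσ hX).mp hφ.2⟩

theorem existsUnique_isDensityMatrix {μ : minTensor π →L[ℂ] ℂ} (hμ : IsState μ) :
    ∃! ρ, IsDensityMatrix ρ ∧ IsGivenBy π μ ρ := by
  obtain ⟨ρ, hρ, huniq⟩ := existsUnique_matrix μ
  exact ⟨ρ, ⟨(isState_iff_isDensityMatrix hρ).mp hμ, hρ⟩, fun σ hσ => huniq σ hσ.2⟩

theorem existsUnique_isState (hπ : ∀ i, Function.Injective (π i))
    {ρ : Matrix (∀ i, κ i) (∀ i, κ i) ℂ} (hρ : IsDensityMatrix ρ) :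
    ∃! μ : minTensor π →L[ℂ] ℂ, IsState μ ∧ IsGivenBy π μ ρ := by
  have := nontrivial_of_isDensityMatrix hπ hρ
  obtain ⟨μ, hμ, huniq⟩ := existsUnique_functional (π := π) ρ
  exact ⟨μ, ⟨(isState_iff_isDensityMatrix hμ).mpr hρ, hμ⟩, fun ν hν => huniq ν hν.2⟩

end MatrixTensor

end QHamming

end

theorem mainTheorem8 {ι : Type*} [Fintype ι] [DecidableEq ι] :
    (∀ (A : ι → Type*) [∀ i, CStarAlgebra (A i)] (H : ι → Type*) [∀ i, NormedAddCommGroup (H i)]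
        [∀ i, InnerProductSpace ℂ (H i)] [∀ i, CompleteSpace (H i)]
        (π : ∀ i, A i →⋆ₐ[ℂ] (H i →L[ℂ] H i)), (∀ i, Function.Injective (π i)) →
      ∀ μ ν : QHamming.minTensor π →L[ℂ] ℂ, QHamming.IsState μ → QHamming.IsState ν →
        QHamming.hammingDist π μ ν ≠ ⊤ ∧
        QHamming.hammingDist π μ ν =
          ⨅ (φ : ι → (QHamming.minTensor π →L[ℂ] ℂ))
            (_ : (∀ i, (∀ c ∈ QHamming.tilde π i, φ i c = 0) ∧ QHamming.IsSelfAdjointFunctional (φ i)) ∧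
              μ - ν = ∑ i, φ i),
            ∑ i, QHamming.dualNorm π i (φ i)) ∧
    (∀ (κ : ι → Type*) [∀ i, Fintype (κ i)] [∀ i, DecidableEq (κ i)]
        (H : ι → Type*) [∀ i, NormedAddCommGroup (H i)]
        [∀ i, InnerProductSpace ℂ (H i)] [∀ i, CompleteSpace (H i)]
        (π : ∀ i, CStarMatrix (κ i) (κ i) ℂ →⋆ₐ[ℂ] (H i →L[ℂ] H i)),
        (∀ i, Function.Injective (π i)) →
      (∀ μ : QHamming.minTensor π →L[ℂ] ℂ, QHamming.IsState μ → ∃! ρ, QHamming.IsDensityMatrix ρ ∧ QHamming.IsGivenBy π μ ρ) ∧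
      (∀ ρ, QHamming.IsDensityMatrix ρ → ∃! μ : QHamming.minTensor π →L[ℂ] ℂ, QHamming.IsState μ ∧ QHamming.IsGivenBy π μ ρ) ∧
      (∀ (μ ν : QHamming.minTensor π →L[ℂ] ℂ) (ρ σ : Matrix (∀ i, κ i) (∀ i, κ i) ℂ),
        QHamming.IsState μ → QHamming.IsState ν → QHamming.IsDensityMatrix ρ → QHamming.IsDensityMatrix σ →
        QHamming.IsGivenBy π μ ρ → QHamming.IsGivenBy π ν σ →
        QHamming.hammingDist π μ ν = QHamming.wassersteinOne ρ σ ∧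
        QHamming.hammingDist π μ ν = QHamming.wassersteinOneNeighbor ρ σ)) := by
  refine ⟨?_, ?_⟩
  · intro A _ H _ _ _ π _ μ ν hμ hν
    exact ⟨QHamming.hammingDist_ne_top π hμ hν, QHamming.hammingDist_eq_iInf π hμ hν⟩
  · intro κ _ _ H _ _ _ π hπ
    refine ⟨fun μ hμ => QHamming.existsUnique_isDensityMatrix hμ,
      fun ρ hρ => QHamming.existsUnique_isState hπ hρ, ?_⟩
    intro μ ν ρ σ hμ hν hρ _ hμρ hνσ
    have h := QHamming.hammingDist_eq_wassersteinOne hμ hν hμρ hνσ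
    exact ⟨h, h.trans (QHamming.wassersteinOne_eq_wassersteinOneNeighbor hρ)⟩
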